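/- **Setting.** Graphs are finite undirected multigraphs $G$ with $n$ vertices (parallel edges allowed), whose edges are colored arbitrarily; $G-c$ denotes $G$ without the edges of color $c$. At each vertex $v$, the edges incident to $v$ carry distinct port numbers, which are arbitrary natural numbers of $O(\log n)$ bits, that is, at most $n^k$ for a constant $k$. An $r$-ball $B_G(v,r)=\{u : \operatorname{dist}_G(v,u)\le r\}$ is *proper* if some vertex is at distance exactly $r$ from $v$, and the *ball-packing number* $\mathsf{bp}(G)$ is the maximum integer $r$ such that $G$ has at least $r$ vertex-disjoint proper $r$-balls. A *routing scheme avoiding one forbidden color* assigns to every colored, port-numbered graph $G$ a routing table (a bit string) for each vertex and a label (a bit string) for each vertex and each color, and has a fixed deterministic routing algorithm that does not depend on $G$. Given the labels of $s$, $t$ and $c$, the algorithm computes an initial header at $s$. At each vertex $v$ where the message arrives, starting with $s$, the algorithm computes, from the table of $v$ and the current header alone, either the decision to stop or a new header and the port number of the next edge to take. It is required that for every color $c$ and all vertices $s,t$ in the same connected component of $G-c$, the message sent from $s$ stops at $t$ after finitely many steps and never takes an edge of color $c$. **Theorem.** There is a deterministic routing scheme avoiding one forbidden color such that, for every edge-colored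 $n$-vertex graph $G$, the following hold, where the constants in the $O$-notation depend only on $k$: * the routing tables stored at the vertices are all of size $O(\mathsf{bp}(G)\log n)$ bits; * the labels assigned to the vertices and to the colors are all of size $O(\mathsf{bp}(G)\log n)$ bits; * for all such $s$, $t$, $c$, the header of the message always has $O(\log n)$ bits. -/

import Mathlib

open scoped Graph

namespace ColorRouting

section BallPacking

variable {V : Type*}

/-- The `r`-ball centred at `v`: all vertices at distance at most `r` from `v`
(distances are `ℕ∞`-valued, infinite between different components). -/
def closedBall (H : SimpleGraph V) (v : V) (r : ℕ) : Set V :=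
  {u | H.edist v u ≤ r}

/-- The `r`-ball centred at `v` is proper if some vertex is at distance exactly `r` from `v`. -/
def IsProperBall (H : SimpleGraph V) (v : V) (r : ℕ) : Prop :=
  ∃ u : V, H.edist v u = r

/-- `H` contains `r` pairwise vertex-disjoint proper `r`-balls. -/
def HasBallPacking (H : SimpleGraph V) (r : ℕ) : Prop :=
  ∃ center : Fin r → V, (∀ i, IsProperBall H (center i) r) ∧
    Pairwise fun i j => Disjoint (closedBall H (center i) r) (closedBall H (center j) r)

/-- The ball-packing number: the largest `r` such that there are `r` vertex-disjoint proper
`r`-balls. (On a finite graph the set is bounded, see `bddAbove_hasBallPacking`, and it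
contains `0`, so the supremum is a maximum.) -/
noncomputable def ballPackingNumber (H : SimpleGraph V) : ℕ :=
  sSup {r : ℕ | HasBallPacking H r}

theorem bddAbove_hasBallPacking [Finite V] (H : SimpleGraph V) :
    BddAbove {r : ℕ | HasBallPacking H r} := by
  refine ⟨Nat.card V, ?_⟩
  rintro r ⟨center, -, hdisj⟩
  have hinj : Function.Injective center := by
    intro i j hij
    by_contra hne
    have hd : Disjoint (closedBall H (center i) r) (closedBall H (center j) r) := hdisj hne
    rw [hij] at hd
    exact Set.disjoint_left.1 hd (show center j ∈ closedBall H (center j) r by simp [closedBall])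
      (by simp [closedBall])
  simpa using Nat.card_le_card_of_injective center hinj

end BallPacking

section Routing

variable {α β γ : Type*}

/-- The ball-packing number of a multigraph: it only depends on the distances in its topology. -/
noncomputable def bp (G : Graph α β) : ℕ :=
  ballPackingNumber G.toSimpleGraph

/-- `G - c`: all edges of color `c` are deleted. -/
def deleteColor (G : Graph α β) (color : β → γ) (c : γ) : Graph α β :=
  G.deleteEdges {e | color e = c}

/-- `u` and `v` are joined by a (possibly trivial) walk of `G`. -/
def Connects (G : Graph α β) (u v : α) : Prop :=
  u ∈ V(G) ∧ Relation.ReflTransGen G.Adj u v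

/-- `port v e` is the port number of the edge `e` at its end `v`. At each vertex, distinct incident
edges have distinct port numbers, and all port numbers are at most `N`. -/
def IsPortNumbering (G : Graph α β) (port : α → β → ℕ) (N : ℕ) : Prop :=
  ∀ v ∈ V(G), Set.InjOn (port v) {e | G.Inc e v} ∧ ∀ e, G.Inc e v → port v e ≤ N

/-- The routing algorithm, one and the same for all graphs and all vertices.

* `start Ls Lt Lc` is the initial header, computed at the source from the labels of the source,
  of the target and of the forbidden color.
* `forward R h` is the decision taken at a vertex that has the table `R` when a message with
  header `h` is there: `some (p, h')` sends the message through port `p` with the new header `h'`,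
  and `none` ends the routing at this vertex. -/
structure RoutingAlgorithm where
  start : List Bool → List Bool → List Bool → List Bool
  forward : List Bool → List Bool → Option (ℕ × List Bool)
  start_computable :
    Computable fun x : List Bool × List Bool × List Bool => start x.1 x.2.1 x.2.2
  forward_computable :
    Computable fun x : List Bool × List Bool => forward x.1 x.2

/-- `Delivers alg G color port table c b t v h`: a message with header `h` at the vertex `v`, when
forwarded by `alg` with the given tables, reaches `t` after finitely many steps and stops there; it
never takes an edge of color `c`, and its header never has more than `b` bits. -/
inductive Delivers (alg : RoutingAlgorithm) (G : Graph α β) (color : β → γ) (port : α → β → ℕ)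
    (table : α → List Bool) (c : γ) (b : ℝ) (t : α) : α → List Bool → Prop
  | arrive {h : List Bool} (hb : (h.length : ℝ) ≤ b) (hend : alg.forward (table t) h = none) :
      Delivers alg G color port table c b t t h
  | hop {v w : α} {e : β} {h h' : List Bool} {p : ℕ} (hb : (h.length : ℝ) ≤ b)
      (hsend : alg.forward (table v) h = some (p, h')) (hlink : G.IsLink e v w)
      (hport : port v e = p) (hcolor : color e ≠ c)
      (hnext : Delivers alg G color port table c b t w h') :
      Delivers alg G color port table c b t v h

end Routing

end ColorRouting

namespace ColorRouting

/-! Fix a breadth-first spanning tree in every component of `G`. Deleting the color `c` cuts these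
trees into fragments. The top of a fragment is a tree root or a vertex whose parent edge has color
`c`. So a vertex that is not a root is a top for one color only, and its own table has room for what
its fragment must remember about that color. Fragments joined by edges of other colors form a graph
whose components correspond to those of `G - c`. Each component gets a spanning tree of fragments,
rooted at the fragment of the tree root if it contains one.

A message makes depth-first tours on two levels: through a tree of fragments and, inside each
fragment, in search of `t` or of the vertex where the edge to the next fragment starts. No memory at
the vertices is needed, since a first child and a next sibling are stored in a form that serves
every forbidden color (`codeTriple_spec`). The message climbs to its top, carries the fragment tour
on until it ends at the root fragment, restarts there, and then must meet `t`.

One datum does not fit into tables: a tree root is a top for every color, and its first child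
fragment depends on the color. At most `bp G` trees are deeper than `bp G`, because their roots are
centres of disjoint proper balls of radius `bp G + 1` (`exists_deep_roots`); a color label lists the
datum for these. In a shallow tree a vertex label lists it for the at most `bp G` colors on the path
to the root. If `c` cuts `s` or `t` off the root, one of the labels has the entry; if it cuts off
neither, the entry is not needed (`lookupPair_labels`).

Delivery is shown backwards, from `t` to `s`. The lemmas `down_of_descends` and `fin_of_descends`
about tours of ordered forests serve both levels, and `run_of_reachable` combines them. -/

/-! ### A self-delimiting code for lists of natural numbers -/

section Coding

/-- Moves the last binary digit of the first component, marked by `true`, to the front of the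
bit string. -/
def codeStep (p : ℕ × List Bool) : ℕ × List Bool :=
  (p.1.div2, if p.1 = 0 then p.2 else true :: p.1.bodd :: p.2)

/-- Prepends the code of `m` to the bit string `l`. -/
def codeNat (m : ℕ) (l : List Bool) : List Bool :=
  -- `m` rounds are enough to exhaust the digits of `m`; once the number is `0`, further rounds are
  -- idle. The bit `false` ends the digits.
  (codeStep^[m] (m, false :: l)).2

/-- The code of a list of natural numbers. -/
def encodeList (l : List ℕ) : List Bool :=
  l.foldr codeNat []

/-- One step of the decoding automaton. Its state consists of a flag (whether the next bit is a
binary digit), the number that is being read, and the numbers that have been read. -/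
def decodeStep (s : Bool × ℕ × List ℕ) (b : Bool) : Bool × ℕ × List ℕ :=
  bif s.1 then (false, 2 * s.2.1 + (bif b then 1 else 0), s.2.2)
  else bif b then (true, s.2) else (false, 0, s.2.2 ++ [s.2.1])

/-- The decoder of `encodeList`. -/
def decodeList (l : List Bool) : List ℕ :=
  (l.foldl decodeStep (false, 0, [])).2.2

/-- Invariant of the encoder: a digit moved to the string is read back first, so a decoder started
with the number still to be encoded always gets the same result. -/
theorem foldl_decodeStep_iterate_codeStep (j : ℕ) (p : ℕ × List Bool) (out : List ℕ) :
    (codeStep^[j] p).2.foldl decodeStep (false, (codeStep^[j] p).1, out) =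
      p.2.foldl decodeStep (false, p.1, out) := by
  induction j generalizing p with
  | zero => rfl
  | succ j ih =>
    rw [Function.iterate_succ_apply, ih]
    rcases p with ⟨q, l⟩
    by_cases hq : q = 0
    · subst hq; simp [codeStep]
    · have h := Nat.bodd_add_div2 q
      have : 2 * q.div2 + (bif q.bodd then 1 else 0) = q := by
        cases hb : q.bodd <;> simp [hb] at h ⊢ <;> omega
      simp [codeStep, hq, decodeStep, this]

theorem iterate_codeStep_fst (j : ℕ) (p : ℕ × List Bool) (h : p.1 ≤ j) :
    (codeStep^[j] p).1 = 0 := by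
  induction j generalizing p with
  | zero => simpa using h
  | succ j ih =>
    rw [Function.iterate_succ_apply]
    apply ih
    simp only [codeStep, Nat.div2_val]
    omega

theorem foldl_decodeStep_codeNat (m : ℕ) (l : List Bool) (out : List ℕ) :
    (codeNat m l).foldl decodeStep (false, 0, out) =
      l.foldl decodeStep (false, 0, out ++ [m]) := by
  have h := foldl_decodeStep_iterate_codeStep m (m, false :: l) out
  rw [iterate_codeStep_fst m _ le_rfl] at h
  exact h

theorem decodeList_encodeList (l : List ℕ) : decodeList (encodeList l) = l := by
  have h : ∀ out, (encodeList l).foldl decodeStep (false, 0, out) = (false, 0, out ++ l) := by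
    induction l with
    | nil => simp [encodeList]
    | cons m l ih =>
      intro out
      rw [encodeList, List.foldr_cons, foldl_decodeStep_codeNat]
      simpa [encodeList] using ih (out ++ [m])
  simp [decodeList, h]

theorem length_iterate_codeStep (j s : ℕ) (p : ℕ × List Bool) (h : p.1 < 2 ^ s) :
    (codeStep^[j] p).2.length ≤ p.2.length + 2 * s := by
  induction j generalizing p s with
  | zero => simp
  | succ j ih =>
    rw [Function.iterate_succ_apply]
    rcases p with ⟨q, l⟩
    by_cases hq : q = 0
    · subst hq
      simpa [codeStep] using ih s (0, l) h
    · obtain _ | s := s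
      · simp at h; exact absurd h hq
      · have := ih s (codeStep (q, l)) (by
          simp only [codeStep, Nat.div2_val] at h ⊢
          rw [pow_succ] at h; omega)
        simp only [codeStep, hq, if_false, List.length_cons] at this ⊢
        omega

theorem length_encodeList (l : List ℕ) (s : ℕ) (h : ∀ m ∈ l, m < 2 ^ s) :
    (encodeList l).length ≤ l.length * (2 * s + 1) := by
  induction l with
  | nil => simp [encodeList]
  | cons m l ih =>
    have h1 := ih fun a ha => h a (List.mem_cons_of_mem _ ha)
    have h2 := length_iterate_codeStep m s (m, false :: encodeList l) (h m (by simp))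
    have h3 : encodeList (m :: l) = (codeStep^[m] (m, false :: encodeList l)).2 := rfl
    rw [h3, List.length_cons, add_mul]
    simp only [List.length_cons] at h2
    omega

theorem encodeList_ne_nil {l : List ℕ} (h : l ≠ []) : encodeList l ≠ [] := fun h0 =>
  h (by rw [← decodeList_encodeList l, h0]; rfl)

theorem primrec_codeStep : Primrec codeStep := by
  refine Primrec.pair (Primrec.nat_div2.comp Primrec.fst) ?_
  refine Primrec.ite (Primrec.eq.comp Primrec.fst (Primrec.const 0)) Primrec.snd ?_
  exact Primrec.list_cons.comp (Primrec.const true)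
    (Primrec.list_cons.comp (Primrec.nat_bodd.comp Primrec.fst) Primrec.snd)

theorem primrec_codeNat : Primrec₂ codeNat := by
  refine Primrec.snd.comp (Primrec.nat_iterate Primrec.fst
    (Primrec.pair Primrec.fst (Primrec.list_cons.comp (Primrec.const false) Primrec.snd)) ?_)
  exact (primrec_codeStep.comp Primrec.snd).to₂

theorem primrec_encodeList : Primrec encodeList :=
  Primrec.list_foldr Primrec.id (Primrec.const [])
    ((primrec_codeNat.comp (Primrec.fst.comp Primrec.snd) (Primrec.snd.comp Primrec.snd)).to₂)

theorem primrec_decodeStep : Primrec₂ decodeStep := by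
  have hf : Primrec fun p : (Bool × ℕ × List ℕ) × Bool => p.1.1 := Primrec.fst.comp Primrec.fst
  have hm : Primrec fun p : (Bool × ℕ × List ℕ) × Bool => p.1.2.1 :=
    Primrec.fst.comp (Primrec.snd.comp Primrec.fst)
  have ho : Primrec fun p : (Bool × ℕ × List ℕ) × Bool => p.1.2.2 :=
    Primrec.snd.comp (Primrec.snd.comp Primrec.fst)
  refine Primrec.cond hf ?_ (Primrec.cond Primrec.snd ?_ ?_)
  · refine Primrec.pair (Primrec.const false) (Primrec.pair ?_ ho)
    exact Primrec.nat_add.comp (Primrec.nat_mul.comp (Primrec.const 2) hm)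
      (Primrec.cond Primrec.snd (Primrec.const 1) (Primrec.const 0))
  · exact Primrec.pair (Primrec.const true) (Primrec.snd.comp Primrec.fst)
  · exact Primrec.pair (Primrec.const false) (Primrec.pair (Primrec.const 0)
      (Primrec.list_append.comp ho (Primrec.list_cons.comp hm (Primrec.const []))))

theorem primrec_decodeList : Primrec decodeList :=
  Primrec.snd.comp (Primrec.snd.comp (Primrec.list_foldl Primrec.id (Primrec.const (false, 0, []))
    ((primrec_decodeStep.comp (Primrec.fst.comp Primrec.snd) (Primrec.snd.comp Primrec.snd)).to₂)))

end Coding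

/-! ### The routing algorithm

A table is a list of twelve numbers: the name of the vertex; the port to the parent plus one, or
`0` at a root; the color of the edge to the parent; three numbers that describe the port to the
first child; three numbers that describe the port from the parent to the next sibling; and the hops
to the parent fragment, to the next sibling fragment and to the first child fragment.

A header is a list of six numbers: the names of the forbidden color and of the target; the state
(`0` climb to the top of the fragment, `1` enter a vertex on the tour, `q + 2` return from a child
with `q` as the port to be taken next plus one); the hop that the tour is looking for; the command
for the top of the next fragment (`0` visit the fragment, `r + 1` continue with the hop `r`); and
the first child fragment of the fragment of a root.

A hop is `0` or `Nat.pair z p + 1`, for the port `p` of the vertex with the name `z`. -/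

section Algorithm

/-- Port code of the first child (`i = 3`) or of the next sibling (`i = 6`) for the color `c`. -/
def portCode (i : ℕ) (T : List ℕ) (c : ℕ) : ℕ :=
  if T.getD i 0 = c then T.getD (i + 1) 0 else T.getD (i + 2) 0

/-- The vertex with the table `T` is the top of its fragment. -/
def AtTop (T H : List ℕ) : Prop :=
  T.getD 1 0 = 0 ∨ T.getD 2 0 = H.getD 0 0

instance (T H : List ℕ) : Decidable (AtTop T H) := by unfold AtTop; infer_instance

/-- The hop `g` starts at the vertex with the table `T`. -/
def HopHere (T : List ℕ) (g : ℕ) : Prop :=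
  g ≠ 0 ∧ (Nat.unpair (g - 1)).1 = T.getD 0 0

instance (T : List ℕ) (g : ℕ) : Decidable (HopHere T g) := by unfold HopHere; infer_instance

/-- The header `H` with a new state, goal and command. -/
def updateHeader (H : List ℕ) (st g K : ℕ) : List ℕ :=
  [H.getD 0 0, H.getD 1 0, st, g, K, H.getD 5 0]

/-- Start a tour of the fragment, at its top, that looks for the hop `g`. -/
def seek (T H : List ℕ) (g K : ℕ) : Option (ℕ × List ℕ) :=
  if HopHere T g then some ((Nat.unpair (g - 1)).2, updateHeader H 0 0 K)
  else if portCode 3 T (H.getD 0 0) ≠ 0 then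
    some (portCode 3 T (H.getD 0 0) - 1, updateHeader H 1 g K)
  else none

/-- At the top of a fragment, continue with the hop `r`, or else with the hop to the parent
fragment, or else with `d`. -/
def continueWith (T H : List ℕ) (r : ℕ) (d : Option (ℕ × List ℕ)) : Option (ℕ × List ℕ) :=
  if r ≠ 0 then seek T H r 0
  -- The parent fragment receives the hop to the next sibling fragment as its command; the shift by
  -- one separates "no sibling left" from "visit".
  else if T.getD 9 0 ≠ 0 then seek T H (T.getD 9 0) (T.getD 10 0 + 1)
  else d

/-- One step of the tour of a fragment. -/
def tourStep (T H : List ℕ) (st g K : ℕ) : Option (ℕ × List ℕ) :=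
  if HopHere T g then some ((Nat.unpair (g - 1)).2, updateHeader H 0 0 K)
  else if (if st = 1 then portCode 3 T (H.getD 0 0) else st - 2) ≠ 0 then
    some ((if st = 1 then portCode 3 T (H.getD 0 0) else st - 2) - 1, updateHeader H 1 g K)
  else if AtTop T H then
    -- A tree root is a top for every color, so its first child fragment is read from the header
    -- instead of the table.
    if g = 0 then continueWith T H (if T.getD 1 0 = 0 then H.getD 5 0 else T.getD 11 0) none
    else none
  else some (T.getD 1 0 - 1, updateHeader H (portCode 6 T (H.getD 0 0) + 2) g K)

/-- One step on the way to the top of a fragment. -/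
def climbStep (T H : List ℕ) : Option (ℕ × List ℕ) :=
  if AtTop T H then
    if H.getD 4 0 = 0 then tourStep T H 1 0 0
    -- The default applies when there is neither a pending hop nor a parent fragment: the tour
    -- starts anew at the root fragment.
    else continueWith T H (H.getD 4 0 - 1) (tourStep T H 1 0 0)
  else some (T.getD 1 0 - 1, updateHeader H 0 0 (H.getD 4 0))

/-- The routing decision at a vertex with the table `T` for a message with the header `H`. -/
def step (T H : List ℕ) : Option (ℕ × List ℕ) :=
  if T.getD 0 0 = H.getD 1 0 then none
  else if H.getD 2 0 = 0 then climbStep T H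
  else tourStep T H (H.getD 2 0) (H.getD 3 0) (H.getD 4 0)

/-- The value that belongs to the key `k` in a list of pairs. -/
def lookupPair (k : ℕ) (l : List ℕ) : ℕ :=
  l.foldr (fun e r => if (Nat.unpair e).1 = k then (Nat.unpair e).2 else r) 0

/-- The initial header. -/
def initialHeader (Ls Lt Lc : List ℕ) : List ℕ :=
  -- Command `1` makes the top of the first fragment act as if the fragments below it were done and
  -- no sibling were left.
  [Lc.getD 0 0, Lt.getD 0 0, 0, 0, 1,
    lookupPair (Nat.pair (Ls.getD 1 0) (Lc.getD 0 0)) (Ls.drop 2 ++ (Lt.drop 2 ++ Lc.drop 1))]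

variable {σ : Type*} [Primcodable σ] {T H : σ → List ℕ} {a b d : σ → ℕ}

theorem primrec_getD (hT : Primrec T) (i : ℕ) : Primrec fun x => (T x).getD i 0 :=
  (Primrec.list_getD 0).comp hT (Primrec.const i)

theorem primrec_portCode (i : ℕ) (hT : Primrec T) (ha : Primrec a) :
    Primrec fun x => portCode i (T x) (a x) :=
  Primrec.ite (Primrec.eq.comp (primrec_getD hT _) ha) (primrec_getD hT _) (primrec_getD hT _)

theorem primrecPred_atTop (hT : Primrec T) (hH : Primrec H) :
    PrimrecPred fun x => AtTop (T x) (H x) :=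
  (Primrec.eq.comp (primrec_getD hT _) (Primrec.const 0)).or
    (Primrec.eq.comp (primrec_getD hT _) (primrec_getD hH _))

theorem primrec_sub_const (ha : Primrec a) (i : ℕ) : Primrec fun x => a x - i :=
  Primrec.nat_sub.comp ha (Primrec.const i)

theorem primrec_add_const (ha : Primrec a) (i : ℕ) : Primrec fun x => a x + i :=
  Primrec.nat_add.comp ha (Primrec.const i)

theorem primrecPred_eq_zero (ha : Primrec a) : PrimrecPred fun x => a x = 0 :=
  Primrec.eq.comp ha (Primrec.const 0)

theorem primrecPred_hopHere (hT : Primrec T) (ha : Primrec a) :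
    PrimrecPred fun x => HopHere (T x) (a x) :=
  (primrecPred_eq_zero ha).not.and (Primrec.eq.comp
    (Primrec.fst.comp (Primrec.unpair.comp (primrec_sub_const ha 1))) (primrec_getD hT _))

theorem primrec_updateHeader (hH : Primrec H) (ha : Primrec a) (hb : Primrec b) (hd : Primrec d) :
    Primrec fun x => updateHeader (H x) (a x) (b x) (d x) :=
  Primrec.list_cons.comp (primrec_getD hH _) <| Primrec.list_cons.comp (primrec_getD hH _) <|
  Primrec.list_cons.comp ha <| Primrec.list_cons.comp hb <| Primrec.list_cons.comp hd <|
  Primrec.list_cons.comp (primrec_getD hH _) <| Primrec.const []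

theorem primrec_hop (hH : Primrec H) (ha : Primrec a) (hd : Primrec d) :
    Primrec fun x => some ((Nat.unpair (a x - 1)).2, updateHeader (H x) 0 0 (d x)) :=
  Primrec.option_some.comp <| Primrec.pair
    (Primrec.snd.comp (Primrec.unpair.comp (primrec_sub_const ha 1)))
    (primrec_updateHeader hH (Primrec.const 0) (Primrec.const 0) hd)

theorem primrec_seek (hT : Primrec T) (hH : Primrec H) (ha : Primrec a) (hd : Primrec d) :
    Primrec fun x => seek (T x) (H x) (a x) (d x) := by
  have hc := primrec_portCode 3 hT (primrec_getD hH 0)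
  exact Primrec.ite (primrecPred_hopHere hT ha) (primrec_hop hH ha hd) <|
    Primrec.ite (primrecPred_eq_zero hc).not (Primrec.option_some.comp <|
      Primrec.pair (primrec_sub_const hc 1) (primrec_updateHeader hH (Primrec.const 1) ha hd))
      (Primrec.const none)

theorem primrec_continueWith {f : σ → Option (ℕ × List ℕ)} (hT : Primrec T) (hH : Primrec H)
    (ha : Primrec a) (hf : Primrec f) : Primrec fun x => continueWith (T x) (H x) (a x) (f x) :=
  Primrec.ite (primrecPred_eq_zero ha).not (primrec_seek hT hH ha (Primrec.const 0)) <|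
    Primrec.ite (primrecPred_eq_zero (primrec_getD hT _)).not
      (primrec_seek hT hH (primrec_getD hT _) (primrec_add_const (primrec_getD hT _) 1)) hf

theorem primrec_tourStep (hT : Primrec T) (hH : Primrec H) (ha : Primrec a) (hb : Primrec b)
    (hd : Primrec d) : Primrec fun x => tourStep (T x) (H x) (a x) (b x) (d x) := by
  have hq : Primrec fun x =>
      if a x = 1 then portCode 3 (T x) ((H x).getD 0 0) else a x - 2 :=
    Primrec.ite (Primrec.eq.comp ha (Primrec.const 1))
      (primrec_portCode 3 hT (primrec_getD hH 0)) (primrec_sub_const ha 2)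
  refine Primrec.ite (primrecPred_hopHere hT hb) (primrec_hop hH hb hd) <|
    Primrec.ite (primrecPred_eq_zero hq).not (Primrec.option_some.comp <| Primrec.pair
      (primrec_sub_const hq 1) (primrec_updateHeader hH (Primrec.const 1) hb hd)) <|
    Primrec.ite (primrecPred_atTop hT hH) (Primrec.ite (primrecPred_eq_zero hb)
      (primrec_continueWith hT hH ?_ (Primrec.const none)) (Primrec.const none)) <|
    Primrec.option_some.comp <| Primrec.pair (primrec_sub_const (primrec_getD hT _) 1) ?_
  · exact Primrec.ite (primrecPred_eq_zero (primrec_getD hT _)) (primrec_getD hH _)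
      (primrec_getD hT _)
  · exact primrec_updateHeader hH
      (primrec_add_const (primrec_portCode 6 hT (primrec_getD hH 0)) 2) hb hd

theorem primrec_climbStep (hT : Primrec T) (hH : Primrec H) :
    Primrec fun x => climbStep (T x) (H x) := by
  have ht := primrec_tourStep hT hH (Primrec.const 1) (Primrec.const 0) (Primrec.const 0)
  exact Primrec.ite (primrecPred_atTop hT hH)
    (Primrec.ite (primrecPred_eq_zero (primrec_getD hH _)) ht
      (primrec_continueWith hT hH (primrec_sub_const (primrec_getD hH _) 1) ht)) <|
    Primrec.option_some.comp <| Primrec.pair (primrec_sub_const (primrec_getD hT _) 1)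
      (primrec_updateHeader hH (Primrec.const 0) (Primrec.const 0) (primrec_getD hH _))

theorem primrec_step (hT : Primrec T) (hH : Primrec H) : Primrec fun x => step (T x) (H x) :=
  Primrec.ite (Primrec.eq.comp (primrec_getD hT _) (primrec_getD hH _)) (Primrec.const none) <|
    Primrec.ite (primrecPred_eq_zero (primrec_getD hH _)) (primrec_climbStep hT hH)
      (primrec_tourStep hT hH (primrec_getD hH _) (primrec_getD hH _) (primrec_getD hH _))

theorem primrec_lookupPair (ha : Primrec a) (hT : Primrec T) :
    Primrec fun x => lookupPair (a x) (T x) := by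
  have hu : Primrec fun y : σ × ℕ × ℕ => Nat.unpair y.2.1 :=
    Primrec.unpair.comp (Primrec.fst.comp Primrec.snd)
  refine Primrec.list_foldr hT (Primrec.const 0) (Primrec.to₂ (f := fun y : σ × ℕ × ℕ =>
    if (Nat.unpair y.2.1).1 = a y.1 then (Nat.unpair y.2.1).2 else y.2.2) ?_)
  exact Primrec.ite (Primrec.eq.comp (Primrec.fst.comp hu) (ha.comp Primrec.fst))
    (Primrec.snd.comp hu) (Primrec.snd.comp Primrec.snd)

theorem primrec_initialHeader {L : σ → List ℕ} (hT : Primrec T) (hH : Primrec H)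
    (hL : Primrec L) : Primrec fun x => initialHeader (T x) (H x) (L x) := by
  refine Primrec.list_cons.comp (primrec_getD hL _) <|
    Primrec.list_cons.comp (primrec_getD hH _) <| Primrec.list_cons.comp (Primrec.const 0) <|
    Primrec.list_cons.comp (Primrec.const 0) <| Primrec.list_cons.comp (Primrec.const 1) <|
    Primrec.list_cons.comp (primrec_lookupPair ?_ ?_) (Primrec.const [])
  · exact Primrec₂.natPair.comp (primrec_getD hT _) (primrec_getD hL _)
  · exact Primrec.list_append.comp (Primrec.list_drop.comp (Primrec.const 2) hT)
      (Primrec.list_append.comp (Primrec.list_drop.comp (Primrec.const 2) hH)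
        (Primrec.list_drop.comp (Primrec.const 1) hL))

/-- The routing algorithm that tours the fragments of a spanning forest. -/
def tourAlgorithm : RoutingAlgorithm where
  -- Empty labels are used when no edge joins distinct vertices. The header must then be empty too,
  -- since for a single vertex `log n = 0`.
  start Ls Lt Lc := if Ls = [] then [] else
    encodeList (initialHeader (decodeList Ls) (decodeList Lt) (decodeList Lc))
  forward R h := (step (decodeList R) (decodeList h)).map fun y => (y.1, encodeList y.2)
  start_computable := by
    refine Primrec.to_comp (Primrec.ite (Primrec.eq.comp Primrec.fst (Primrec.const []))
      (Primrec.const []) (primrec_encodeList.comp (primrec_initialHeader ?_ ?_ ?_)))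
    · exact primrec_decodeList.comp Primrec.fst
    · exact primrec_decodeList.comp (Primrec.fst.comp Primrec.snd)
    · exact primrec_decodeList.comp (Primrec.snd.comp Primrec.snd)
  forward_computable := by
    refine Primrec.to_comp (Primrec.option_map (primrec_step (primrec_decodeList.comp Primrec.fst)
      (primrec_decodeList.comp Primrec.snd)) ?_)
    exact Primrec₂.mk (Primrec.pair (Primrec.fst.comp Primrec.snd)
      (primrec_encodeList.comp (Primrec.snd.comp Primrec.snd)))

end Algorithm

/-! ### Tours of ordered forests -/

section Forest

variable {X : Type*} (id : X → ℕ)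

open Classical in
/-- An element of the set with the least name, if there is one. -/
noncomputable def minOption (s : Set X) : Option X :=
  if h : s.Nonempty then some (Function.argminOn id s h) else none

variable {id}

theorem minOption_eq_none {s : Set X} : minOption id s = none ↔ ∀ x, x ∉ s := by
  unfold minOption
  split_ifs with h
  · simpa [Set.Nonempty] using h
  · simpa [Set.Nonempty] using h

theorem minOption_mem {s : Set X} {x : X} (h : minOption id s = some x) : x ∈ s := by
  unfold minOption at h
  split_ifs at h with hs
  cases h
  exact Function.argminOn_mem id s hs

theorem minOption_le {s : Set X} {x y : X} (h : minOption id s = some x) (hy : y ∈ s) :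
    id x ≤ id y := by
  unfold minOption at h
  split_ifs at h with hs
  cases h
  exact Function.argminOn_le id s hy

theorem exists_minOption {s : Set X} {y : X} (hy : y ∈ s) :
    ∃ x, minOption id s = some x ∧ x ∈ s ∧ id x ≤ id y := by
  rcases h : minOption id s with _ | x
  · exact absurd hy (minOption_eq_none.1 h y)
  · exact ⟨x, rfl, minOption_mem h, minOption_le h hy⟩

theorem minOption_eq_of_subset (hid : Function.Injective id) {s t : Set X} {x : X}
    (h : minOption id s = some x) (hts : t ⊆ s) (hx : x ∈ t) : minOption id t = some x := by
  obtain ⟨y, hy, hyt, hle⟩ := exists_minOption (id := id) hx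
  rw [hy, hid (le_antisymm hle (minOption_le h (hts hyt)))]

variable (id)

/-- The first child of `u` in the forest with the parent function `up`. -/
noncomputable def firstChild (up : X → Option X) (u : X) : Option X :=
  minOption id {w | up w = some u}

/-- The next sibling of `w` in the forest with the parent function `up`. -/
noncomputable def nextSibling (up : X → Option X) (w : X) : Option X :=
  minOption id {w' | (∃ u, up w = some u ∧ up w' = some u) ∧ id w < id w'}

variable {id} {up : X → Option X} {rank : X → ℕ}

/-- `a` is a descendant of `b` in the forest with the parent function `up`. -/
abbrev Descends (up : X → Option X) (a b : X) : Prop :=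
  Relation.ReflTransGen (fun v u => up v = some u) a b

theorem exists_top (hrank : ∀ v u, up v = some u → rank u < rank v) (v : X) :
    ∃ u, Descends up v u ∧ up u = none := by
  induction h : rank v using Nat.strong_induction_on generalizing v with
  | _ n ih =>
    rcases hv : up v with _ | u
    · exact ⟨v, .refl, hv⟩
    · obtain ⟨w, hw, hn⟩ := ih (rank u) (h ▸ hrank v u hv) u rfl
      exact ⟨w, .head hv hw, hn⟩

theorem Descends.eq_of_up_eq_none {a b : X} (h : Descends up a b) (ha : up a = none) : b = a := by
  rcases h.cases_head with h | ⟨c, hc, -⟩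
  · exact h.symm
  · simp [ha] at hc

theorem Descends.unique {a b c : X} (hb : Descends up a b) (hc : Descends up a c)
    (hb' : up b = none) (hc' : up c = none) : b = c := by
  have hu : Relator.RightUnique fun v u => up v = some u := by
    intro v x y hx hy
    exact Option.some_injective _ (hx.symm.trans hy)
  rcases Relation.ReflTransGen.total_of_right_unique hu hb hc with h | h
  · exact (Descends.eq_of_up_eq_none h hb').symm
  · exact Descends.eq_of_up_eq_none h hc'

variable [Finite X] {Down Fin : X → Prop}

/-- Read `Down w` as "a tour that enters `w` succeeds" and `Fin w` as "a tour that has just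
completed the subtree of `w` succeeds". The induction runs backwards along the siblings; `q` selects
those for which success is claimed. -/
theorem tour_siblings
    (h4 : ∀ u w w', up w = some u → nextSibling id up w = some w' → Down w' → Fin w) {u : X}
    {q : X → Prop} (hq : ∀ w, up w = some u → Fin w → Down w)
    (hlast : ∀ w, up w = some u → q w → Down w ∨ (nextSibling id up w = none → Fin w))
    (hnext : ∀ w w', up w = some u → q w → ¬ Down w → nextSibling id up w = some w' → q w') :
    ∀ w, up w = some u → q w → Down w := by
  obtain ⟨N, hN⟩ := (Set.finite_range id).bddAbove
  intro w
  induction h : N - id w using Nat.strong_induction_on generalizing w with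
  | _ n ih =>
    intro hw hqw
    by_contra hd
    refine hd (hq w hw ?_)
    rcases hn : nextSibling id up w with _ | w'
    · exact ((hlast w hw hqw).resolve_left hd) hn
    · obtain ⟨⟨v, hv, hv'⟩, hlt⟩ := minOption_mem hn
      obtain rfl : v = u := Option.some_injective _ (hv.symm.trans hw)
      have := hN (Set.mem_range_self w')
      exact h4 _ _ _ hw hn (ih (N - id w') (by omega) w' rfl hv' (hnext w w' hw hqw hd hn))

section
-- `h2` to `h5` are the single moves of a tour: descend to the first child, turn around at a leaf,
-- pass to the next sibling, return to the parent after the last child.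
variable (hrank : ∀ v u, up v = some u → rank u < rank v)
  (h2 : ∀ u w, firstChild id up u = some w → Down w → Down u)
  (h3 : ∀ u, firstChild id up u = none → Fin u → Down u)
  (h4 : ∀ u w w', up w = some u → nextSibling id up w = some w' → Down w' → Fin w)
  (h5 : ∀ u w, up w = some u → nextSibling id up w = none → Fin u → Fin w)
include hrank h2 h3 h4 h5

/-- If a tour can be completed after the subtree of `u`, then it can be completed from `u`. -/
theorem down_of_fin (u : X) (hu : Fin u) : Down u := by
  obtain ⟨N, hN⟩ := (Set.finite_range rank).bddAbove
  induction h : N - rank u using Nat.strong_induction_on generalizing u with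
  | _ n ih =>
    rcases hf : firstChild id up u with _ | w
    · exact h3 u hf hu
    · have hw : up w = some u := minOption_mem (s := {w | up w = some u}) hf
      refine h2 u w hf (tour_siblings (q := fun _ => True) h4 ?_ ?_ ?_ w hw trivial)
      · intro w hw hfin
        have := hN (Set.mem_range_self w)
        have := hrank w u hw
        exact ih (N - rank w) (by omega) w hfin rfl
      · exact fun w hw _ => Or.inr fun hn => h5 u w hw hn hu
      · exact fun _ _ _ _ _ _ => trivial

/-- If a vertex in the subtree of `u` is hit, then the tour can be completed from `u`. -/
theorem down_of_descends (hid : Function.Injective id) {u w : X} (hw : Down w)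
    (h : Descends up w u) : Down u := by
  induction h with
  | refl => exact hw
  | @tail v u _ hv ih =>
    have hdf := down_of_fin hrank h2 h3 h4 h5
    obtain ⟨w₁, hw₁, hmem, hle⟩ := exists_minOption (id := id) (s := {w | up w = some u}) hv
    -- Only the siblings up to `v` matter: `v` itself succeeds and none before it is the last, so
    -- `Fin u` is not required.
    refine h2 u w₁ hw₁ (tour_siblings (u := u) (q := fun x => id x ≤ id v) h4
      (fun w _ => hdf w) ?_ ?_ w₁ hmem hle)
    · intro x hx hxv
      rcases eq_or_lt_of_le hxv with h | h
      · exact Or.inl (hid h ▸ ih)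
      · exact Or.inr fun hn => absurd ⟨⟨u, hx, hv⟩, h⟩ (minOption_eq_none.1 hn v)
    · intro x x' hx hxv hd hn
      rcases eq_or_lt_of_le hxv with h | h
      · exact absurd (hid h ▸ ih) hd
      · exact minOption_le hn ⟨⟨u, hx, hv⟩, h⟩

/-- If the tour can be completed after the whole tree, then it can be completed after any subtree
of it. -/
theorem fin_of_descends {u w : X} (hu : Fin u) (h : Descends up w u) : Fin w := by
  have hdf := down_of_fin hrank h2 h3 h4 h5
  induction h using Relation.ReflTransGen.head_induction_on with
  | refl => exact hu
  | @head w v hw _ ih =>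
    rcases hn : nextSibling id up w with _ | w'
    · exact h5 v w hw hn ih
    · obtain ⟨⟨x, hx, hx'⟩, -⟩ := minOption_mem hn
      obtain rfl : x = v := Option.some_injective _ (hx.symm.trans hw)
      refine h4 _ _ _ hw hn (tour_siblings (q := fun _ => True) h4 (fun w _ => hdf w) ?_
        (fun _ _ _ _ _ _ => trivial) w' hx' trivial)
      exact fun y hy _ => Or.inr fun hn => h5 _ y hy hn ih

end

end Forest

/-! ### Breadth-first spanning forests -/

section BFS

variable {X : Type*} (H : SimpleGraph X)

theorem exists_root (R : Set X) (hR : ∀ a ∈ R, ∀ b ∈ R, H.Reachable a b → a = b) :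
    ∃ root : X → X, (∀ v, H.Reachable (root v) v) ∧
      (∀ u v, H.Reachable u v → root u = root v) ∧ ∀ v ∈ R, root v = v := by
  classical
  have hex : ∀ C : H.ConnectedComponent, ∃ r, H.connectedComponentMk r = C ∧
      ∀ v ∈ R, H.connectedComponentMk v = C → r = v := by
    intro C
    by_cases h : ∃ v ∈ R, H.connectedComponentMk v = C
    · obtain ⟨r, hr, hC⟩ := h
      refine ⟨r, hC, fun v hv hvC => hR r hr v hv ?_⟩
      exact SimpleGraph.ConnectedComponent.exact (hC.trans hvC.symm)
    · obtain ⟨r, hr⟩ := C.exists_rep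
      exact ⟨r, hr, fun v hv hvC => absurd ⟨v, hv, hvC⟩ h⟩
  choose f hf hfR using hex
  refine ⟨fun v => f (H.connectedComponentMk v), fun v => ?_, fun u v h => ?_, fun v hv => ?_⟩
  · exact SimpleGraph.ConnectedComponent.exact (hf _)
  · exact congrArg f (SimpleGraph.ConnectedComponent.sound h)
  · exact hfR _ v hv rfl

theorem exists_adj_dist_add_one {r v : X} (h : H.Reachable r v) (hne : v ≠ r) :
    ∃ w, H.Adj v w ∧ H.dist r w + 1 = H.dist r v := by
  obtain ⟨p, hp⟩ := h.symm.exists_walk_length_eq_dist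
  cases p with
  | nil => exact absurd rfl hne
  | @cons _ w _ hadj p =>
    refine ⟨w, hadj, ?_⟩
    have h1 : H.dist w r ≤ p.length := SimpleGraph.dist_le p
    obtain ⟨p', hp'⟩ := (p.reachable).exists_walk_length_eq_dist
    have h2 : H.dist v r ≤ (SimpleGraph.Walk.cons hadj p').length := SimpleGraph.dist_le _
    simp only [SimpleGraph.Walk.length_cons] at hp h2
    rw [SimpleGraph.dist_comm, H.dist_comm (u := r)]
    omega

/-- A spanning forest of breadth-first trees, given by its roots and parents; the roots may be
prescribed in some of the components. -/
theorem exists_bfs_forest (R : Set X) (hR : ∀ a ∈ R, ∀ b ∈ R, H.Reachable a b → a = b) :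
    ∃ root par : X → X, (∀ v, H.Reachable (root v) v) ∧
      (∀ u v, H.Reachable u v → root u = root v) ∧ (∀ v ∈ R, root v = v) ∧
      ∀ v, v ≠ root v → H.Adj v (par v) ∧ H.dist (root v) (par v) + 1 = H.dist (root v) v := by
  classical
  obtain ⟨root, h1, h2, h3⟩ := exists_root H R hR
  have : ∀ v, ∃ w, v ≠ root v → H.Adj v w ∧ H.dist (root v) w + 1 = H.dist (root v) v := by
    intro v
    by_cases h : v = root v
    · exact ⟨v, fun h' => absurd h h'⟩
    · obtain ⟨w, hw⟩ := exists_adj_dist_add_one H (h1 v) h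
      exact ⟨w, fun _ => hw⟩
  choose par hpar using this
  exact ⟨root, par, h1, h2, h3, hpar⟩

end BFS

/-! ### Tables for the tours and the delivery of the messages -/

/-- A finite colored, port-numbered graph with names for vertices and colors and a rooted spanning
forest. -/
structure RootedNetwork (X β γ : Type*) where
  /-- `link e u v` says that the edge `e` joins `u` and `v`. -/
  link : β → X → X → Prop
  /-- The color of an edge. -/
  color : β → γ
  /-- The port number of an edge at a vertex. -/
  port : X → β → ℕ
  /-- The name of a vertex. -/
  id : X → ℕ
  /-- The name of a color. -/
  cid : γ → ℕ
  /-- The root of the tree that contains the vertex. -/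
  root : X → X
  /-- The parent of a vertex that is not a root. -/
  par : X → X
  /-- The edge from a vertex that is not a root to its parent. -/
  edge : X → β
  /-- The depth of a vertex in its tree. -/
  depth : X → ℕ
  link_symm : ∀ {e u v}, link e u v → link e v u
  id_injective : Function.Injective id
  -- Colors that occur on no edge may share a name, so there may be infinitely many of them.
  eq_of_cid_eq : ∀ {e u v c}, link e u v → cid (color e) = cid c → color e = c
  link_edge : ∀ {v}, v ≠ root v → link (edge v) v (par v)
  depth_par : ∀ {v}, v ≠ root v → depth (par v) + 1 = depth v
  root_eq : ∀ {e u v}, link e u v → root u = root v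

namespace RootedNetwork

variable {X β γ : Type*} (S : RootedNetwork X β γ) (c : γ)

open Classical in
/-- The parent function of the spanning forest. -/
noncomputable def treeUp (v : X) : Option X :=
  if v = S.root v then none else some (S.par v)

open Classical in
/-- The parent function of the spanning forest without the edges of color `c`. -/
noncomputable def up (v : X) : Option X :=
  if v = S.root v ∨ S.color (S.edge v) = c then none else some (S.par v)

variable {S c}

theorem treeUp_eq_some {v u : X} : S.treeUp v = some u ↔ v ≠ S.root v ∧ S.par v = u := by
  unfold treeUp
  split_ifs with h
  · exact ⟨fun h' => by simp at h', fun h' => absurd h h'.1⟩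
  · exact ⟨fun h' => ⟨h, Option.some_injective _ h'⟩, fun h' => by rw [h'.2]⟩

theorem up_eq_some {v u : X} :
    S.up c v = some u ↔ S.treeUp v = some u ∧ S.color (S.edge v) ≠ c := by
  rw [treeUp_eq_some]
  unfold up
  split_ifs with h
  · simp only [false_iff]
    tauto
  · rw [not_or] at h
    simp [h]

theorem up_eq_none {v : X} : S.up c v = none ↔ v = S.root v ∨ S.color (S.edge v) = c := by
  unfold up
  split_ifs with h <;> simp [h]

theorem link_of_treeUp {v u : X} (h : S.treeUp v = some u) : S.link (S.edge v) v u := by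
  obtain ⟨h1, rfl⟩ := treeUp_eq_some.1 h
  exact S.link_edge h1

theorem depth_lt_of_up {v u : X} (h : S.up c v = some u) : S.depth u < S.depth v := by
  obtain ⟨h1, rfl⟩ := treeUp_eq_some.1 (up_eq_some.1 h).1
  have := S.depth_par h1
  omega

variable (S c)

/-- The top of the fragment of `v`, that is, of its tree in the spanning forest without the edges
of color `c`. -/
noncomputable def top (v : X) : X :=
  (exists_top (up := S.up c) (rank := S.depth) (fun _ _ => depth_lt_of_up) v).choose

theorem descends_top (v : X) : Descends (S.up c) v (S.top c v) :=
  (exists_top (up := S.up c) (rank := S.depth) (fun _ _ => depth_lt_of_up) v).choose_spec.1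

theorem up_top (v : X) : S.up c (S.top c v) = none :=
  (exists_top (up := S.up c) (rank := S.depth) (fun _ _ => depth_lt_of_up) v).choose_spec.2

variable {S c}

theorem root_top (v : X) : S.root (S.top c v) = S.root v := by
  have h := S.descends_top c v
  generalize S.top c v = w at h
  induction h with
  | refl => rfl
  | tail _ h ih => rw [← ih, S.root_eq (link_of_treeUp (up_eq_some.1 h).1)]

variable (S c)

/-- The graph of the fragments, which are represented by their tops. -/
def fragGraph : SimpleGraph X where
  -- Vertices that are not tops are isolated here.
  Adj u w := u ≠ w ∧ ∃ e x y, S.link e x y ∧ S.color e ≠ c ∧ S.top c x = u ∧ S.top c y = w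
  symm := ⟨fun _ _ ⟨h, e, x, y, h1, h2, h3, h4⟩ => ⟨h.symm, e, y, x, S.link_symm h1, h2, h4, h3⟩⟩
  loopless := ⟨fun _ h => h.1 rfl⟩

theorem up_eq_none_of_adj {u w : X} (h : (S.fragGraph c).Adj u w) : S.up c u = none := by
  obtain ⟨-, e, x, y, -, -, rfl, -⟩ := h
  exact S.up_top c x

/-- Every edge of the graph stays within one tree of the spanning forest. Hence a component of the
fragment graph contains at most one tree root, which may be prescribed as its root. -/
theorem root_eq_of_reachable {u w : X} (h : (S.fragGraph c).Reachable u w) :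
    S.root u = S.root w := by
  obtain ⟨p⟩ := h
  induction p with
  | nil => rfl
  | cons h _ ih =>
    obtain ⟨-, e, x, y, hl, -, rfl, rfl⟩ := h
    rw [← ih, root_top, root_top, S.root_eq hl]

/-- Prescribing the tree roots spares them data about parent and sibling fragments, which would
depend on the color. -/
theorem exists_fragForest : ∃ root par : X → X, (∀ v, (S.fragGraph c).Reachable (root v) v) ∧
    (∀ u v, (S.fragGraph c).Reachable u v → root u = root v) ∧
    (∀ v ∈ {v | v = S.root v}, root v = v) ∧
    ∀ v, v ≠ root v → (S.fragGraph c).Adj v (par v) ∧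
      (S.fragGraph c).dist (root v) (par v) + 1 = (S.fragGraph c).dist (root v) v :=
  exists_bfs_forest _ _ fun _ ha _ hb h =>
    Eq.trans ha ((S.root_eq_of_reachable c h).trans (Eq.symm hb))

/-- The root of the component of `v` in the graph of the fragments. -/
noncomputable def fragRoot : X → X := (S.exists_fragForest c).choose

/-- The parents in a spanning forest of the graph of the fragments. -/
noncomputable def fragPar : X → X := (S.exists_fragForest c).choose_spec.choose

theorem fragRoot_reachable (v : X) : (S.fragGraph c).Reachable (S.fragRoot c v) v :=
  (S.exists_fragForest c).choose_spec.choose_spec.1 v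

variable {S c}

theorem fragRoot_eq {u v : X} (h : (S.fragGraph c).Reachable u v) :
    S.fragRoot c u = S.fragRoot c v :=
  (S.exists_fragForest c).choose_spec.choose_spec.2.1 u v h

theorem fragRoot_eq_self {v : X} (h : v = S.root v) : S.fragRoot c v = v :=
  (S.exists_fragForest c).choose_spec.choose_spec.2.2.1 v h

theorem adj_fragPar {v : X} (h : v ≠ S.fragRoot c v) : (S.fragGraph c).Adj v (S.fragPar c v) ∧
    (S.fragGraph c).dist (S.fragRoot c v) (S.fragPar c v) + 1 =
      (S.fragGraph c).dist (S.fragRoot c v) v :=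
  (S.exists_fragForest c).choose_spec.choose_spec.2.2.2 v h

variable (S c)

open Classical in
/-- The parent function of the spanning forest of the graph of the fragments. -/
noncomputable def fragUp (v : X) : Option X :=
  if v = S.fragRoot c v then none else some (S.fragPar c v)

variable {S c}

theorem fragUp_eq_some {v u : X} :
    S.fragUp c v = some u ↔ v ≠ S.fragRoot c v ∧ S.fragPar c v = u := by
  unfold fragUp
  split_ifs with h
  · exact ⟨fun h' => by simp at h', fun h' => absurd h h'.1⟩
  · exact ⟨fun h' => ⟨h, Option.some_injective _ h'⟩, fun h' => by rw [h'.2]⟩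

theorem fragUp_eq_none {v : X} : S.fragUp c v = none ↔ v = S.fragRoot c v := by
  unfold fragUp
  split_ifs with h
  · exact iff_of_true rfl h
  · exact iff_of_false (by simp) h

theorem adj_of_fragUp {v u : X} (h : S.fragUp c v = some u) : (S.fragGraph c).Adj v u := by
  obtain ⟨h1, rfl⟩ := fragUp_eq_some.1 h
  exact (adj_fragPar h1).1

theorem fragRoot_of_fragUp {v u : X} (h : S.fragUp c v = some u) :
    S.fragRoot c v = S.fragRoot c u :=
  fragRoot_eq (adj_of_fragUp h).reachable

theorem fragRank_lt {v u : X} (h : S.fragUp c v = some u) :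
    (S.fragGraph c).dist (S.fragRoot c u) u < (S.fragGraph c).dist (S.fragRoot c v) v := by
  rw [← fragRoot_of_fragUp h]
  obtain ⟨h1, rfl⟩ := fragUp_eq_some.1 h
  have := (adj_fragPar h1).2
  omega

theorem descends_fragRoot (v : X) : Descends (S.fragUp c) v (S.fragRoot c v) := by
  obtain ⟨u, hu, hn⟩ := exists_top (up := S.fragUp c)
    (rank := fun v => (S.fragGraph c).dist (S.fragRoot c v) v) (fun _ _ => fragRank_lt) v
  have : S.fragRoot c v = S.fragRoot c u := by
    clear hn
    induction hu with
    | refl => rfl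
    | tail _ h ih => rw [ih, fragRoot_of_fragUp h]
  rwa [this, ← fragUp_eq_none.1 hn]

variable (S c)

/-- The edge `q.1` leads from the vertex `q.2.1` of the fragment with the top `v` to the vertex
`q.2.2` of its parent fragment. -/
def IsExit (v : X) (q : β × X × X) : Prop :=
  ∃ u, S.fragUp c v = some u ∧ S.link q.1 q.2.1 q.2.2 ∧ S.color q.1 ≠ c ∧
    S.top c q.2.1 = v ∧ S.top c q.2.2 = u

variable {S c} in
theorem exists_isExit {v u : X} (h : S.fragUp c v = some u) : ∃ q, S.IsExit c v q := by
  obtain ⟨-, e, x, y, h1, h2, h3, h4⟩ := adj_of_fragUp h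
  exact ⟨(e, x, y), u, h, h1, h2, h3, h4⟩

/-- The hop through the edge `e` at its end `z`. -/
def hop (z : X) (e : β) : ℕ := Nat.pair (S.id z) (S.port z e) + 1

open Classical in
/-- The hop from the fragment with the top `v` to its parent fragment. -/
noncomputable def exitHop (v : X) : ℕ :=
  if h : ∃ q, S.IsExit c v q then S.hop h.choose.2.1 h.choose.1 else 0

open Classical in
/-- The hop from its parent fragment to the fragment with the top `v`. -/
noncomputable def entryHop (v : X) : ℕ :=
  if h : ∃ q, S.IsExit c v q then S.hop h.choose.2.2 h.choose.1 else 0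

/-- The hop to the first child fragment. -/
noncomputable def firstHop (v : X) : ℕ :=
  (firstChild S.id (S.fragUp c) v).elim 0 (S.entryHop c)

/-- The hop to the next sibling fragment. -/
noncomputable def nextHop (v : X) : ℕ :=
  (nextSibling S.id (S.fragUp c) v).elim 0 (S.entryHop c)

/-- The port from the parent to the vertex, plus one. -/
def childCode (o : Option X) : ℕ :=
  o.elim 0 fun w => S.port (S.par w) (S.edge w) + 1

/-- The names of the color of the first edge and the codes of the first vertices that are needed to
find, for each color, the first vertex of `s` with an edge of another color. -/
noncomputable def codeTriple (s : Set X) : List ℕ :=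
  [(minOption S.id s).elim 0 fun w => S.cid (S.color (S.edge w)),
    (minOption S.id s).elim 0 fun w =>
      S.childCode (minOption S.id {w' ∈ s | S.color (S.edge w') ≠ S.color (S.edge w)}),
    S.childCode (minOption S.id s)]

-- Two candidates serve all colors: the first vertex `w` of `s`, unless its edge has color `c`; in
-- that case the first vertex whose edge differs in color from that of `w`.
variable {S} in
theorem codeTriple_spec {s : Set X} (hs : ∀ w ∈ s, w ≠ S.root w) :
    (if (S.codeTriple s).getD 0 0 = S.cid c then (S.codeTriple s).getD 1 0
      else (S.codeTriple s).getD 2 0) =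
      S.childCode (minOption S.id {w ∈ s | S.color (S.edge w) ≠ c}) := by
  rcases h : minOption S.id s with _ | w
  · have h' : minOption S.id {w ∈ s | S.color (S.edge w) ≠ c} = none :=
      minOption_eq_none.2 fun x hx => minOption_eq_none.1 h x hx.1
    simp [codeTriple, h, h', childCode]
  · have hw := minOption_mem h
    by_cases hc : S.color (S.edge w) = c
    · simp [codeTriple, h, hc]
    · have h1 : S.cid (S.color (S.edge w)) ≠ S.cid c := fun h1 =>
        hc (S.eq_of_cid_eq (S.link_edge (hs w hw)) h1)
      have h2 := minOption_eq_of_subset (t := {w ∈ s | S.color (S.edge w) ≠ c}) S.id_injective h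
        (fun x hx => hx.1) ⟨hw, hc⟩
      simp [codeTriple, h, h1, h2]

open Classical in
/-- The port to the parent plus one, or `0` at a root. -/
noncomputable def upCode (v : X) : ℕ :=
  if v = S.root v then 0 else S.port v (S.edge v) + 1

open Classical in
/-- The routing table of a vertex. -/
noncomputable def table (v : X) : List ℕ :=
  [S.id v, S.upCode v, S.cid (S.color (S.edge v))] ++
    S.codeTriple {w | S.treeUp w = some v} ++
    S.codeTriple {w | (∃ u, S.treeUp v = some u ∧ S.treeUp w = some u) ∧ S.id v < S.id w} ++
    -- A vertex other than a root is a top only for the color of its parent edge, so data for this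
    -- color suffice. At a root, `0` means that there is no parent fragment, and the two numbers
    -- after it are never used.
    [if v = S.root v then 0 else S.exitHop (S.color (S.edge v)) v,
      S.nextHop (S.color (S.edge v)) v, S.firstHop (S.color (S.edge v)) v]

/-- The header with the state `st`, the goal `g` and the command `K`. -/
def header (t : X) (f₀ st g K : ℕ) : List ℕ :=
  [S.cid c, S.id t, st, g, K, f₀]

/-- A header is admissible if it consists of six numbers that are at most `M`. -/
def Admissible (M : ℕ) (h : List ℕ) : Prop :=
  h.length = 6 ∧ ∀ a ∈ h, a ≤ M

/-- The message with the header `h` at the vertex `v` is delivered to `t`. -/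
inductive Run (t : X) (M : ℕ) : X → List ℕ → Prop
  | arrive {h} (hh : Admissible M h) (hs : step (S.table t) h = none) : Run t M t h
  | hop {v w e h h' p} (hh : Admissible M h) (hs : step (S.table v) h = some (p, h'))
      (hl : S.link e v w) (hp : S.port v e = p) (hc : S.color e ≠ c) (hr : Run t M w h') :
      Run t M v h

variable {S c} {t : X} {M N f₀ : ℕ}

/-- Allows a decision at a top to be treated as if the message had arrived with another header,
possibly one that is never sent. -/
theorem Run.congr {v : X} {h h' : List ℕ} (hr : S.Run c t M v h) (hh : Admissible M h')
    (hs : step (S.table v) h' = step (S.table v) h) : S.Run c t M v h' := by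
  cases hr with
  | arrive _ h2 => exact .arrive hh (hs.trans h2)
  | hop _ h2 hl hp hc hr => exact .hop hh (hs.trans h2) hl hp hc hr

theorem portCode_three (v : X) :
    portCode 3 (S.table v) (S.cid c) = S.childCode (firstChild S.id (S.up c) v) := by
  have h := codeTriple_spec (S := S) c (s := {w | S.treeUp w = some v})
    (fun w hw => (treeUp_eq_some.1 hw).1)
  refine Eq.trans ?_ (h.trans ?_)
  · rfl
  · congr 2
    ext w
    exact up_eq_some.symm

theorem portCode_six {v u : X} (hv : S.up c v = some u) :
    portCode 6 (S.table v) (S.cid c) = S.childCode (nextSibling S.id (S.up c) v) := by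
  have h := codeTriple_spec (S := S) c
    (s := {w | (∃ u, S.treeUp v = some u ∧ S.treeUp w = some u) ∧ S.id v < S.id w})
    (fun w hw => (treeUp_eq_some.1 hw.1.choose_spec.2).1)
  refine Eq.trans ?_ (h.trans ?_)
  · rfl
  · congr 2
    ext w
    simp only [Set.mem_ofPred_eq, up_eq_some]
    have := (up_eq_some.1 hv).2
    constructor
    · rintro ⟨⟨⟨x, h1, h2⟩, h3⟩, h4⟩
      exact ⟨⟨x, ⟨h1, this⟩, h2, h4⟩, h3⟩
    · rintro ⟨⟨x, ⟨h1, -⟩, h2, h4⟩, h3⟩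
      exact ⟨⟨⟨x, h1, h2⟩, h3⟩, h4⟩

theorem upCode_eq_zero {v : X} : S.upCode v = 0 ↔ v = S.root v := by
  unfold upCode
  split_ifs with h
  · exact iff_of_true rfl h
  · exact iff_of_false (by simp) h

theorem upCode_of_ne {v : X} (h : v ≠ S.root v) : S.upCode v = S.port v (S.edge v) + 1 :=
  if_neg h

theorem atTop_iff {v : X} {st g K : ℕ} :
    AtTop (S.table v) (S.header c t f₀ st g K) ↔ S.up c v = none := by
  have h1 : (S.table v).getD 1 0 = S.upCode v := rfl
  have h2 : (S.table v).getD 2 0 = S.cid (S.color (S.edge v)) := rfl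
  have h3 : (S.header c t f₀ st g K).getD 0 0 = S.cid c := rfl
  rw [AtTop, up_eq_none, h1, h2, h3, upCode_eq_zero]
  by_cases hv : v = S.root v
  · exact iff_of_true (Or.inl hv) (Or.inl hv)
  · exact or_congr_right ⟨fun h => S.eq_of_cid_eq (S.link_edge hv) h, fun h => by rw [h]⟩

theorem hopHere_iff {v z : X} {e : β} : HopHere (S.table v) (S.hop z e) ↔ z = v := by
  have h1 : (S.table v).getD 0 0 = S.id v := rfl
  rw [HopHere, h1, hop, Nat.add_sub_cancel, Nat.unpair_pair, S.id_injective.eq_iff]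
  exact and_iff_right (Nat.succ_ne_zero _)

theorem hop_ne_zero {z : X} {e : β} : S.hop z e ≠ 0 := Nat.succ_ne_zero _

theorem step_of_eq {h : List ℕ} (h1 : h.getD 1 0 = S.id t) : step (S.table t) h = none :=
  if_pos h1.symm

theorem step_climb {v : X} (hv : v ≠ t) {g K : ℕ} : step (S.table v) (S.header c t f₀ 0 g K) =
    climbStep (S.table v) (S.header c t f₀ 0 g K) := by
  have h : ¬ (S.table v).getD 0 0 = (S.header c t f₀ 0 g K).getD 1 0 := fun h =>
    hv (S.id_injective h)
  rw [step, if_neg h, if_pos (by rfl)]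

theorem step_tour {v : X} (hv : v ≠ t) {st g K : ℕ} (hst : st ≠ 0) :
    step (S.table v) (S.header c t f₀ st g K) =
      tourStep (S.table v) (S.header c t f₀ st g K) st g K := by
  have h : ¬ (S.table v).getD 0 0 = (S.header c t f₀ st g K).getD 1 0 := fun h =>
    hv (S.id_injective h)
  have h' : ¬ (S.header c t f₀ st g K).getD 2 0 = 0 := hst
  rw [step, if_neg h, if_neg h']
  rfl

/-- All names, port numbers and colors are at most `N`, and `M` is large enough for the headers. -/
structure Bounds (S : RootedNetwork X β γ) (N M : ℕ) : Prop where
  id_le : ∀ v, S.id v ≤ N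
  cid_le : ∀ c, S.cid c ≤ N
  port_le : ∀ {e u v}, S.link e u v → S.port u e ≤ N
  le : (N + 1) ^ 2 + 2 ≤ M

theorem Bounds.le' (hB : S.Bounds N M) : N + 3 ≤ M := by
  have := hB.le
  nlinarith

theorem Bounds.hop_le (hB : S.Bounds N M) {e : β} {u v : X} (h : S.link e u v) :
    S.hop u e ≤ (N + 1) ^ 2 := by
  have h1 := Nat.pair_lt_max_add_one_sq (S.id u) (S.port u e)
  have h2 : max (S.id u) (S.port u e) ≤ N := max_le (hB.id_le u) (hB.port_le h)
  exact h1.trans_le (Nat.pow_le_pow_left (by omega) 2)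

theorem Bounds.exitHop_le (hB : S.Bounds N M) (v : X) : S.exitHop c v ≤ (N + 1) ^ 2 := by
  unfold exitHop
  split_ifs with h
  · exact hB.hop_le h.choose_spec.choose_spec.2.1
  · exact Nat.zero_le _

theorem Bounds.entryHop_le (hB : S.Bounds N M) (v : X) : S.entryHop c v ≤ (N + 1) ^ 2 := by
  unfold entryHop
  split_ifs with h
  · exact hB.hop_le (S.link_symm h.choose_spec.choose_spec.2.1)
  · exact Nat.zero_le _

theorem Bounds.firstHop_le (hB : S.Bounds N M) (v : X) : S.firstHop c v ≤ (N + 1) ^ 2 := by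
  unfold firstHop
  rcases firstChild S.id (S.fragUp c) v with _ | w
  · exact Nat.zero_le _
  · exact hB.entryHop_le w

theorem Bounds.nextHop_le (hB : S.Bounds N M) (v : X) : S.nextHop c v ≤ (N + 1) ^ 2 := by
  unfold nextHop
  rcases nextSibling S.id (S.fragUp c) v with _ | w
  · exact Nat.zero_le _
  · exact hB.entryHop_le w

theorem Bounds.childCode_le (hB : S.Bounds N M) {w u : X} (h : S.treeUp w = some u) :
    S.childCode (some w) ≤ N + 1 := by
  have h' := link_of_treeUp h
  obtain ⟨-, rfl⟩ := treeUp_eq_some.1 h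
  exact Nat.succ_le_succ (hB.port_le (S.link_symm h'))

theorem Bounds.admissible (hB : S.Bounds N M) (hf : f₀ ≤ M) {st g K : ℕ} (hst : st ≤ M)
    (hg : g ≤ M) (hK : K ≤ M) : Admissible M (S.header c t f₀ st g K) := by
  have := hB.le'
  have := hB.id_le t
  have := hB.cid_le c
  refine ⟨rfl, ?_⟩
  simp only [header, List.mem_cons, List.not_mem_nil, or_false, forall_eq_or_imp, forall_eq]
  omega

/-! ### Delivery inside one fragment -/

section Delivery

variable (hB : S.Bounds N M) (hf : f₀ ≤ M)
include hB hf

theorem run_of_eq {st g K : ℕ} (hst : st ≤ M) (hg : g ≤ M) (hK : K ≤ M) :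
    S.Run c t M t (S.header c t f₀ st g K) :=
  .arrive (hB.admissible hf hst hg hK) (step_of_eq rfl)

theorem run_climb {K : ℕ} (hK : K ≤ M) {v : X}
    (h : S.Run c t M (S.top c v) (S.header c t f₀ 0 0 K)) :
    S.Run c t M v (S.header c t f₀ 0 0 K) := by
  have hd := S.descends_top c v
  generalize S.top c v = w at h hd
  induction hd using Relation.ReflTransGen.head_induction_on with
  | refl => exact h
  | @head v u hv _ ih =>
    by_cases hvt : v = t
    · subst hvt
      exact run_of_eq hB hf (Nat.zero_le _) (Nat.zero_le _) hK
    obtain ⟨hv', hc⟩ := up_eq_some.1 hv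
    obtain ⟨hroot, -⟩ := treeUp_eq_some.1 hv'
    refine .hop (hB.admissible hf (Nat.zero_le _) (Nat.zero_le _) hK) ?_ (link_of_treeUp hv') rfl
      hc ih
    have h1 : (S.table v).getD 1 0 = S.upCode v := rfl
    rw [step_climb hvt, climbStep, if_neg (by rw [atTop_iff, hv]; simp), h1, upCode_of_ne hroot]
    rfl

section Tour

variable {g K : ℕ} (hg : g ≤ M) (hK : K ≤ M)
  -- Success once the tour reaches the start of the hop `g`; vacuous for `g = 0`, when only `t` is
  -- sought.
  (hhere : ∀ v st, st ≠ 0 → st ≤ M → HopHere (S.table v) g →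
    S.Run c t M v (S.header c t f₀ st g K))
include hg hK hhere

theorem run_tour_child {u w : X} {st : ℕ} (hst : st ≠ 0) (hst' : st ≤ M) (hw : S.up c w = some u)
    (hst'' : (if st = 1 then portCode 3 (S.table u) (S.cid c) else st - 2) =
      S.childCode (some w))
    (h : S.Run c t M w (S.header c t f₀ 1 g K)) : S.Run c t M u (S.header c t f₀ st g K) := by
  by_cases hut : u = t
  · subst hut
    exact run_of_eq hB hf hst' hg hK
  by_cases hh : HopHere (S.table u) g
  · exact hhere u st hst hst' hh
  obtain ⟨hw', hc⟩ := up_eq_some.1 hw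
  refine .hop (hB.admissible hf hst' hg hK) ?_ (S.link_symm (link_of_treeUp hw')) rfl hc h
  have h0 : (S.header c t f₀ st g K).getD 0 0 = S.cid c := rfl
  obtain ⟨-, rfl⟩ := treeUp_eq_some.1 hw'
  rw [step_tour hut hst, tourStep, if_neg hh, h0, hst'',
    if_pos (show S.childCode (some w) ≠ 0 from Nat.succ_ne_zero _)]
  rfl

theorem run_tour_parent {u w : X} (hw : S.up c w = some u)
    (h : S.Run c t M u
      (S.header c t f₀ (S.childCode (nextSibling S.id (S.up c) w) + 2) g K)) :
    S.Run c t M w (S.header c t f₀ 2 g K) := by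
  have hM := hB.le'
  by_cases hwt : w = t
  · subst hwt
    exact run_of_eq hB hf (by omega) hg hK
  by_cases hh : HopHere (S.table w) g
  · exact hhere w 2 two_ne_zero (by omega) hh
  obtain ⟨hw', hc⟩ := up_eq_some.1 hw
  obtain ⟨hroot, -⟩ := treeUp_eq_some.1 hw'
  refine .hop (hB.admissible hf (by omega) hg hK) ?_ (link_of_treeUp hw') rfl hc h
  have h1 : (S.table w).getD 1 0 = S.upCode w := rfl
  have h0 : (S.header c t f₀ 2 g K).getD 0 0 = S.cid c := rfl
  rw [step_tour hwt two_ne_zero, tourStep, if_neg hh, if_neg (by simp),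
    if_neg (by rw [atTop_iff, hw]; simp), h0, portCode_six hw, h1, upCode_of_ne hroot]
  rfl

/-- State `1` plays the role of `Down`; state `2`, a return with no child left, plays that of `Fin`.
At a vertex without children both states trigger the same decision. -/
theorem tour_hypotheses :
    (∀ u w, firstChild S.id (S.up c) u = some w → S.Run c t M w (S.header c t f₀ 1 g K) →
      S.Run c t M u (S.header c t f₀ 1 g K)) ∧
    (∀ u, firstChild S.id (S.up c) u = none → S.Run c t M u (S.header c t f₀ 2 g K) →
      S.Run c t M u (S.header c t f₀ 1 g K)) ∧
    (∀ u w w', S.up c w = some u → nextSibling S.id (S.up c) w = some w' →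
      S.Run c t M w' (S.header c t f₀ 1 g K) → S.Run c t M w (S.header c t f₀ 2 g K)) ∧
    (∀ u w, S.up c w = some u → nextSibling S.id (S.up c) w = none →
      S.Run c t M u (S.header c t f₀ 2 g K) → S.Run c t M w (S.header c t f₀ 2 g K)) := by
  have hM := hB.le'
  refine ⟨fun u w hw h => ?_, fun u hn h => ?_, fun u w w' hw hn h => ?_, fun u w hw hn h => ?_⟩
  · refine run_tour_child hB hf hg hK hhere one_ne_zero (by omega)
      (minOption_mem (s := {w | S.up c w = some u}) hw) ?_ h
    rw [if_pos rfl, portCode_three, hw]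
  · refine h.congr (hB.admissible hf (by omega) hg hK) ?_
    by_cases hut : u = t
    · subst hut
      rw [step_of_eq rfl, step_of_eq rfl]
    · have h0 : ∀ st, (S.header c t f₀ st g K).getD 0 0 = S.cid c := fun _ => rfl
      have h1 : portCode 3 (S.table u) (S.cid c) = 0 := by rw [portCode_three, hn]; rfl
      have h2 : ∀ st st', updateHeader (S.header c t f₀ st g K) st' g K =
        S.header c t f₀ st' g K := fun _ _ => rfl
      have h3 : ∀ st, updateHeader (S.header c t f₀ st g K) 0 0 K =
        S.header c t f₀ 0 0 K := fun _ => rfl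
      rw [step_tour hut one_ne_zero, step_tour hut two_ne_zero]
      simp only [tourStep, h0, h1, h2, h3, atTop_iff, if_true]
      rfl
  · obtain ⟨⟨x, hx, hx'⟩, -⟩ := minOption_mem hn
    obtain rfl : x = u := Option.some_injective _ (hx.symm.trans hw)
    have hle := hB.childCode_le (up_eq_some.1 hx').1
    refine run_tour_parent hB hf hg hK hhere hw ?_
    rw [hn]
    refine run_tour_child hB hf hg hK hhere (by omega) (by omega) hx' ?_ h
    rw [if_neg (by simp [childCode]), Nat.add_sub_cancel]
  · refine run_tour_parent hB hf hg hK hhere hw ?_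
    rw [hn]
    exact h

variable [Finite X]

theorem run_tour_of_finish {u : X} (h : S.Run c t M u (S.header c t f₀ 2 g K)) :
    S.Run c t M u (S.header c t f₀ 1 g K) := by
  obtain ⟨h2, h3, h4, h5⟩ := tour_hypotheses hB hf hg hK hhere
  exact down_of_fin (Down := fun u => S.Run c t M u (S.header c t f₀ 1 g K))
    (Fin := fun u => S.Run c t M u (S.header c t f₀ 2 g K)) (rank := S.depth)
    (fun _ _ => depth_lt_of_up) h2 h3 h4 h5 u h

theorem run_tour_of_hit {u w : X} (hw : w = t ∨ HopHere (S.table w) g)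
    (h : Descends (S.up c) w u) : S.Run c t M u (S.header c t f₀ 1 g K) := by
  obtain ⟨h2, h3, h4, h5⟩ := tour_hypotheses hB hf hg hK hhere
  have hM := hB.le'
  refine down_of_descends (Down := fun u => S.Run c t M u (S.header c t f₀ 1 g K))
    (Fin := fun u => S.Run c t M u (S.header c t f₀ 2 g K)) (rank := S.depth)
    (fun _ _ => depth_lt_of_up) h2 h3 h4 h5 S.id_injective ?_ h
  rcases hw with rfl | hw
  · exact run_of_eq hB hf (by omega) hg hK
  · exact hhere w 1 one_ne_zero (by omega) hw

end Tour

variable [Finite X]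

/-- The tour finds a hop that starts in the fragment. -/
theorem run_seek {v z z' : X} {e : β} {K : ℕ} (hl : S.link e z z') (hc : S.color e ≠ c)
    (hz : S.top c z = v) (hK : K ≤ M) (h : S.Run c t M z' (S.header c t f₀ 0 0 K)) :
    S.Run c t M v (S.header c t f₀ 1 (S.hop z e) K) := by
  have hg : S.hop z e ≤ M := (hB.hop_le hl).trans (by have := hB.le; omega)
  refine run_tour_of_hit hB hf hg hK ?_ (w := z) (Or.inr (hopHere_iff.2 rfl))
    (hz ▸ S.descends_top c z)
  intro w st hst hst' hh
  obtain rfl := hopHere_iff.1 hh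
  by_cases hzt : z = t
  · subst hzt
    exact run_of_eq hB hf hst' hg hK
  refine .hop (hB.admissible hf hst' hg hK) ?_ hl rfl hc h
  rw [step_tour hzt hst, tourStep, if_pos hh]
  simp only [hop, Nat.add_sub_cancel, Nat.unpair_pair]
  rfl

omit hB hf [Finite X] in
-- At a top, `seek` acts like a tour that enters the top with the new goal; where it gives up, the
-- tour with a nonzero goal stops as well.
theorem seek_eq_tourStep {v : X} (hv : S.up c v = none) {st g K g' K' : ℕ} (hg : g' ≠ 0) :
    seek (S.table v) (S.header c t f₀ st g K) g' K' =
      tourStep (S.table v) (S.header c t f₀ 1 g' K') 1 g' K' := by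
  have h2 : ∀ st g K a b d, updateHeader (S.header c t f₀ st g K) a b d =
    S.header c t f₀ a b d := fun _ _ _ _ _ _ => rfl
  have h0 : ∀ st g K, (S.header c t f₀ st g K).getD 0 0 = S.cid c := fun _ _ _ => rfl
  simp only [seek, tourStep, h0, h2, atTop_iff, hv, hg, if_true, if_false]

omit hB hf [Finite X] in
theorem step_climb_visit {v : X} (hv : S.up c v = none) :
    step (S.table v) (S.header c t f₀ 0 0 0) = step (S.table v) (S.header c t f₀ 1 0 0) := by
  by_cases hvt : v = t
  · subst hvt
    rw [step_of_eq rfl, step_of_eq rfl]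
  · rw [step_climb hvt, step_tour hvt one_ne_zero, climbStep, if_pos (atTop_iff.2 hv),
      if_pos (by rfl)]
    rfl

theorem run_visit_of_hit {v : X} (h : S.top c t = v) :
    S.Run c t M v (S.header c t f₀ 0 0 0) := by
  refine Run.congr ?_ (hB.admissible hf (Nat.zero_le _) (Nat.zero_le _) (Nat.zero_le _))
    (step_climb_visit (h ▸ S.up_top c t))
  exact run_tour_of_hit hB hf (Nat.zero_le _) (Nat.zero_le _)
    (fun w st _ _ hh => absurd rfl hh.1) (Or.inl rfl) (h ▸ S.descends_top c t)

theorem run_visit_of_finish {v : X} (hv : S.up c v = none)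
    (h : S.Run c t M v (S.header c t f₀ 2 0 0)) : S.Run c t M v (S.header c t f₀ 0 0 0) := by
  refine Run.congr ?_ (hB.admissible hf (Nat.zero_le _) (Nat.zero_le _) (Nat.zero_le _))
    (step_climb_visit hv)
  exact run_tour_of_finish hB hf (Nat.zero_le _) (Nat.zero_le _)
    (fun w st _ _ hh => absurd rfl hh.1) h

end Delivery

end RootedNetwork

/-! ### Delivery along the tree of fragments -/

namespace RootedNetwork

variable {X β γ : Type*} {S : RootedNetwork X β γ} {c : γ} {t : X} {M N f₀ : ℕ}

theorem exists_exit {v u : X} (h : S.fragUp c v = some u) : ∃ e x y, S.link e x y ∧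
    S.color e ≠ c ∧ S.top c x = v ∧ S.top c y = u ∧ S.exitHop c v = S.hop x e ∧
    S.entryHop c v = S.hop y e := by
  have hq := exists_isExit h
  obtain ⟨u', hu', h1, h2, h3, h4⟩ := hq.choose_spec
  obtain rfl : u' = u := Option.some_injective _ (hu'.symm.trans h)
  exact ⟨_, _, _, h1, h2, h3, h4, dif_pos hq, dif_pos hq⟩

theorem exitHop_eq_zero {v : X} (h : v = S.fragRoot c v) : S.exitHop c v = 0 := by
  refine dif_neg ?_
  rintro ⟨q, u, hu, -⟩
  rw [fragUp_eq_none.2 h] at hu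
  simp at hu

theorem table_exitHop {v : X} (hv : S.up c v = none) :
    (S.table v).getD 9 0 = S.exitHop c v := by
  classical
  have h9 : (S.table v).getD 9 0 =
    if v = S.root v then 0 else S.exitHop (S.color (S.edge v)) v := by
      simp only [table]; congr
  rw [h9]
  split_ifs with h
  · exact (exitHop_eq_zero (fragRoot_eq_self h).symm).symm
  · rw [(up_eq_none.1 hv).resolve_left h]

theorem table_nextHop {v : X} (hv : S.up c v = none) (hr : v ≠ S.root v) :
    (S.table v).getD 10 0 = S.nextHop c v := by
  have h : (S.table v).getD 10 0 = S.nextHop (S.color (S.edge v)) v := rfl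
  rw [h, (up_eq_none.1 hv).resolve_left hr]

theorem table_firstHop {v : X} (hv : S.up c v = none) (hr : v ≠ S.root v) :
    (S.table v).getD 11 0 = S.firstHop c v := by
  have h : (S.table v).getD 11 0 = S.firstHop (S.color (S.edge v)) v := rfl
  rw [h, (up_eq_none.1 hv).resolve_left hr]

theorem ne_root_of_fragUp {v u : X} (h : S.fragUp c v = some u) : v ≠ S.root v := fun h' =>
  (fragUp_eq_some.1 h).1 (fragRoot_eq_self h').symm

theorem up_of_fragUp {v u : X} (h : S.fragUp c v = some u) : S.up c v = none :=
  S.up_eq_none_of_adj c (adj_of_fragUp h)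

theorem up_of_fragUp' {v u : X} (h : S.fragUp c v = some u) : S.up c u = none :=
  S.up_eq_none_of_adj c (adj_of_fragUp h).symm

theorem exitHop_ne_zero {v u : X} (h : S.fragUp c v = some u) : S.exitHop c v ≠ 0 := by
  obtain ⟨e, x, y, -, -, -, -, h, -⟩ := exists_exit h
  rw [h]
  exact hop_ne_zero

theorem entryHop_ne_zero {v u : X} (h : S.fragUp c v = some u) : S.entryHop c v ≠ 0 := by
  obtain ⟨e, x, y, -, -, -, -, -, h⟩ := exists_exit h
  rw [h]
  exact hop_ne_zero

theorem continueWith_of_ne {v : X} (hv : S.up c v = none) (hvt : v ≠ t) {st g K r : ℕ}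
    {d : Option (ℕ × List ℕ)} (hr : r ≠ 0) :
    continueWith (S.table v) (S.header c t f₀ st g K) r d =
      step (S.table v) (S.header c t f₀ 1 r 0) := by
  rw [continueWith, if_pos hr, seek_eq_tourStep hv hr, step_tour hvt one_ne_zero]

theorem continueWith_zero {v u : X} (h : S.fragUp c v = some u) (hvt : v ≠ t) {st g K : ℕ}
    {d : Option (ℕ × List ℕ)} :
    continueWith (S.table v) (S.header c t f₀ st g K) 0 d =
      step (S.table v) (S.header c t f₀ 1 (S.exitHop c v) (S.nextHop c v + 1)) := by
  have hv := up_of_fragUp h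
  rw [continueWith, if_neg (by simp), table_exitHop hv, if_pos (exitHop_ne_zero h),
    table_nextHop hv (ne_root_of_fragUp h), seek_eq_tourStep hv (exitHop_ne_zero h),
    step_tour hvt one_ne_zero]

theorem step_continue {v : X} (hv : S.up c v = none) (hvt : v ≠ t) {r : ℕ} :
    step (S.table v) (S.header c t f₀ 0 0 (r + 1)) =
      continueWith (S.table v) (S.header c t f₀ 0 0 (r + 1)) r
        (tourStep (S.table v) (S.header c t f₀ 0 0 (r + 1)) 1 0 0) := by
  have h : (S.header c t f₀ 0 0 (r + 1)).getD 4 0 = r + 1 := rfl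
  rw [step_climb hvt, climbStep, if_pos (atTop_iff.2 hv), h, if_neg (Nat.succ_ne_zero r),
    Nat.add_sub_cancel]

theorem step_finish {v : X} (hv : S.up c v = none) (hvt : v ≠ t)
    (hF : v = S.root v → f₀ = S.firstHop c v) :
    step (S.table v) (S.header c t f₀ 2 0 0) =
      continueWith (S.table v) (S.header c t f₀ 2 0 0) (S.firstHop c v) none := by
  have h1 : (S.table v).getD 1 0 = S.upCode v := rfl
  have h5 : (S.header c t f₀ 2 0 0).getD 5 0 = f₀ := rfl
  have h : (if (S.table v).getD 1 0 = 0 then (S.header c t f₀ 2 0 0).getD 5 0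
      else (S.table v).getD 11 0) = S.firstHop c v := by
    rw [h1, h5]
    by_cases hr : v = S.root v
    · rw [if_pos (upCode_eq_zero.2 hr), hF hr]
    · rw [if_neg (mt upCode_eq_zero.1 hr), table_firstHop hv hr]
  rw [step_tour hvt two_ne_zero, tourStep, if_neg (fun h => h.1 rfl), if_neg (by simp),
    if_pos (atTop_iff.2 hv), if_pos rfl, h]

section Delivery

variable [Finite X] (hB : S.Bounds N M) (hf : f₀ ≤ M)
include hB hf

theorem run_exit {v u : X} (h : S.fragUp c v = some u) {K : ℕ} (hK : K ≤ M)
    (hr : S.Run c t M u (S.header c t f₀ 0 0 K)) :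
    S.Run c t M v (S.header c t f₀ 1 (S.exitHop c v) K) := by
  obtain ⟨e, x, y, hl, hc, hx, hy, hex, -⟩ := exists_exit h
  rw [hex]
  exact run_seek hB hf hl hc hx hK (run_climb hB hf hK (hy ▸ hr))

theorem run_entry {v u : X} (h : S.fragUp c v = some u)
    (hr : S.Run c t M v (S.header c t f₀ 0 0 0)) :
    S.Run c t M u (S.header c t f₀ 1 (S.entryHop c v) 0) := by
  obtain ⟨e, x, y, hl, hc, hx, hy, -, hen⟩ := exists_exit h
  rw [hen]
  exact run_seek hB hf (S.link_symm hl) hc hy (Nat.zero_le _)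
    (run_climb hB hf (Nat.zero_le _) (hx ▸ hr))

theorem run_continue {v w : X} (h : S.fragUp c w = some v)
    (hr : S.Run c t M w (S.header c t f₀ 0 0 0)) :
    S.Run c t M v (S.header c t f₀ 0 0 (S.entryHop c w + 1)) := by
  have h1 := hB.entryHop_le (c := c) w
  have h2 := hB.le
  refine (run_entry hB hf h hr).congr
    (hB.admissible hf (Nat.zero_le _) (Nat.zero_le _) (by omega)) ?_
  by_cases hvt : v = t
  · subst hvt
    rw [step_of_eq rfl, step_of_eq rfl]
  · rw [step_continue (up_of_fragUp' h) hvt,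
      continueWith_of_ne (up_of_fragUp' h) hvt (entryHop_ne_zero h)]

/-- Siblings are reached through the parent: the message leaves by the exit hop and carries the next
hop as the command for the top of `u`. -/
theorem run_leave {w u : X} (h : S.fragUp c w = some u)
    (hr : S.Run c t M u (S.header c t f₀ 0 0 (S.nextHop c w + 1))) :
    S.Run c t M w (S.header c t f₀ 0 0 1) := by
  have h1 := hB.nextHop_le (c := c) w
  have h2 := hB.le
  refine (run_exit hB hf h (by omega) hr).congr
    (hB.admissible hf (Nat.zero_le _) (Nat.zero_le _) (by omega)) ?_
  by_cases hvt : w = t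
  · subst hvt
    rw [step_of_eq rfl, step_of_eq rfl]
  · rw [step_continue (r := 0) (up_of_fragUp h) hvt, continueWith_zero h hvt]

theorem run_visit_child {v w : X} (hF : v = S.root v → f₀ = S.firstHop c v)
    (hw : firstChild S.id (S.fragUp c) v = some w)
    (hr : S.Run c t M w (S.header c t f₀ 0 0 0)) : S.Run c t M v (S.header c t f₀ 0 0 0) := by
  have h : S.fragUp c w = some v := minOption_mem (s := {w | S.fragUp c w = some v}) hw
  have hv := up_of_fragUp' h
  have hM := hB.le'
  have hfirst : S.firstHop c v = S.entryHop c w := by rw [firstHop, hw]; rfl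
  refine run_visit_of_finish hB hf hv ((run_entry hB hf h hr).congr
    (hB.admissible hf (by omega) (Nat.zero_le _) (Nat.zero_le _)) ?_)
  by_cases hvt : v = t
  · subst hvt
    rw [step_of_eq rfl, step_of_eq rfl]
  · rw [step_finish hv hvt hF, hfirst, continueWith_of_ne hv hvt (entryHop_ne_zero h)]

/-- Without child fragments, the end of a visit triggers the same decision as command `1`: leave for
the parent fragment. -/
theorem run_visit_leaf {v u : X} (h : S.fragUp c v = some u)
    (hn : firstChild S.id (S.fragUp c) v = none)
    (hr : S.Run c t M v (S.header c t f₀ 0 0 1)) : S.Run c t M v (S.header c t f₀ 0 0 0) := by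
  have hv := up_of_fragUp h
  have hM := hB.le'
  have hfirst : S.firstHop c v = 0 := by rw [firstHop, hn]; rfl
  refine run_visit_of_finish hB hf hv (hr.congr
    (hB.admissible hf (by omega) (Nat.zero_le _) (Nat.zero_le _)) ?_)
  by_cases hvt : v = t
  · subst hvt
    rw [step_of_eq rfl, step_of_eq rfl]
  · rw [step_finish hv hvt (fun h' => absurd h' (ne_root_of_fragUp h)), hfirst,
      continueWith_zero h hvt, step_continue (r := 0) hv hvt, continueWith_zero h hvt]

omit [Finite X] in
theorem run_restart {v : X} (hv : S.up c v = none) (h : v = S.fragRoot c v)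
    (hr : S.Run c t M v (S.header c t f₀ 0 0 0)) : S.Run c t M v (S.header c t f₀ 0 0 1) := by
  have hM := hB.le'
  refine hr.congr (hB.admissible hf (Nat.zero_le _) (Nat.zero_le _) (by omega)) ?_
  by_cases hvt : v = t
  · subst hvt
    rw [step_of_eq rfl, step_of_eq rfl]
  · rw [step_continue (r := 0) hv hvt, continueWith, if_neg (by simp), table_exitHop hv,
      exitHop_eq_zero h, if_neg (by simp), step_climb_visit hv, step_tour hvt one_ne_zero]
    rfl

/-- A message that is climbing to the top of its fragment is delivered to every vertex of the same
component. -/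
theorem run_of_reachable {s : X} (hst : (S.fragGraph c).Reachable (S.top c s) (S.top c t))
    (hF : S.top c s = S.root s → S.top c t = S.root s ∨ f₀ = S.firstHop c (S.root s))
    (hF' : S.top c s ≠ S.root s → f₀ = S.firstHop c (S.root s)) :
    S.Run c t M s (S.header c t f₀ 0 0 1) := by
  have hM := hB.le'
  refine run_climb hB hf (by omega) ?_
  -- If `s` and `t` both lie in the fragment of the tree root, the tour of this fragment meets `t`
  -- before `f₀` is consulted.
  by_cases hroot : S.top c s = S.root s ∧ S.top c t = S.root s
  · refine run_restart hB hf (S.up_top c s) ?_ (run_visit_of_hit hB hf ?_)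
    · exact (fragRoot_eq_self ((root_top s).trans hroot.1.symm).symm).symm
    · rw [hroot.1, hroot.2]
  have hfirst : f₀ = S.firstHop c (S.root s) := by
    by_cases h : S.top c s = S.root s
    · exact (hF h).resolve_left fun h' => hroot ⟨h, h'⟩
    · exact hF' h
  clear hroot hF hF'
  obtain ⟨r, hr⟩ : ∃ r, r = S.fragRoot c (S.top c s) := ⟨_, rfl⟩
  have hrt : S.fragRoot c (S.top c t) = r := by rw [hr, fragRoot_eq hst]
  have hreach : ∀ v, S.fragRoot c v = r → (S.fragGraph c).Reachable v (S.top c s) := by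
    intro v hv
    refine (S.fragRoot_reachable c v).symm.trans ?_
    rw [hv, hr]
    exact S.fragRoot_reachable c _
  have hFv : ∀ v, S.fragRoot c v = r → v = S.root v → f₀ = S.firstHop c v := by
    intro v hv hv'
    rw [hfirst, hv', S.root_eq_of_reachable c (hreach v hv), root_top]
  -- Every vertex with this fragment root is a top: it is the top of `s` or has a neighbor in the
  -- fragment graph.
  have hup : ∀ v, S.fragRoot c v = r → S.up c v = none := by
    intro v hv
    obtain ⟨p⟩ := hreach v hv
    cases p with
    | nil => exact S.up_top c s
    | cons h _ => exact S.up_eq_none_of_adj c h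
  -- The premise restricts the tour to the fragment tree of `s`. `Fin r` is taken to be `Down r`,
  -- because a tour that ends at `r` restarts there.
  let Down : X → Prop := fun v => S.fragRoot c v = r → S.Run c t M v (S.header c t f₀ 0 0 0)
  let Fin : X → Prop := fun v =>
    S.fragRoot c v = r →
      (v = r → Down v) ∧ (v ≠ r → S.Run c t M v (S.header c t f₀ 0 0 1))
  have hrr : ∀ v, S.fragRoot c v = r → v ≠ r → ∃ u, S.fragUp c v = some u := fun v hv hne =>
    ⟨_, fragUp_eq_some.2 ⟨fun h => hne (h.trans hv), rfl⟩⟩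
  have hne : ∀ v u, S.fragUp c v = some u → S.fragRoot c v = r → v ≠ r := fun v u h hv h' =>
    (fragUp_eq_some.1 h).1 (h'.trans hv.symm)
  have hfin : ∀ v, Fin v → S.fragRoot c v = r → S.Run c t M v (S.header c t f₀ 0 0 1) := by
    intro v hv hvr
    by_cases h : v = r
    · exact run_restart hB hf (hup v hvr) (h.trans hvr.symm)
        ((hv hvr).1 h hvr)
    · exact (hv hvr).2 h
  have h2 : ∀ u w, firstChild S.id (S.fragUp c) u = some w → Down w → Down u := by
    intro u w hw hd hur
    refine run_visit_child hB hf (hFv u hur) hw (hd ?_)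
    rw [fragRoot_of_fragUp (minOption_mem (s := {w | S.fragUp c w = some u}) hw), hur]
  have h3 : ∀ u, firstChild S.id (S.fragUp c) u = none → Fin u → Down u := by
    intro u hn hfu hur
    by_cases h : u = r
    · exact (hfu hur).1 h hur
    · obtain ⟨x, hx⟩ := hrr u hur h
      exact run_visit_leaf hB hf hx hn (hfin u hfu hur)
  have h4 : ∀ u w w', S.fragUp c w = some u → nextSibling S.id (S.fragUp c) w = some w' →
      Down w' → Fin w := by
    intro u w w' hw hn hd hwr
    refine ⟨fun h => absurd h (hne w u hw hwr), fun _ => ?_⟩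
    obtain ⟨⟨x, hx, hx'⟩, -⟩ := minOption_mem hn
    obtain rfl : x = u := Option.some_injective _ (hx.symm.trans hw)
    refine run_leave hB hf hw ?_
    rw [nextHop, hn]
    refine run_continue hB hf hx' (hd ?_)
    rw [fragRoot_of_fragUp hx', ← fragRoot_of_fragUp hw, hwr]
  have h5 : ∀ u w, S.fragUp c w = some u → nextSibling S.id (S.fragUp c) w = none →
      Fin u → Fin w := by
    intro u w hw hn hfu hwr
    refine ⟨fun h => absurd h (hne w u hw hwr), fun _ => ?_⟩
    refine run_leave hB hf hw ?_
    rw [nextHop, hn]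
    exact hfin u hfu (by rw [← fragRoot_of_fragUp hw, hwr])
  have hrank : ∀ v u, S.fragUp c v = some u →
      (fun v => (S.fragGraph c).dist (S.fragRoot c v) v) u <
        (fun v => (S.fragGraph c).dist (S.fragRoot c v) v) v := fun _ _ => fragRank_lt
  -- This follows from the hit in the fragment of `t` alone, so the restart at `r` involves no
  -- circularity.
  have hdown : Down r := by
    refine down_of_descends (Down := Down) (Fin := Fin) hrank h2 h3 h4 h5 S.id_injective
      (w := S.top c t) (fun _ => run_visit_of_hit hB hf rfl) ?_
    rw [← hrt]
    exact descends_fragRoot _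
  refine hfin _ (fin_of_descends (Down := Down) (Fin := Fin) hrank h2 h3 h4 h5 (u := r) ?_ ?_)
    hr.symm
  · exact fun _ => ⟨fun _ => hdown, fun h => absurd rfl h⟩
  · rw [hr]
    exact descends_fragRoot _

end Delivery

end RootedNetwork
/-! ### Labels -/

section Lookup

theorem lookupPair_eq {k f : ℕ} {l : List ℕ}
    (h : ∀ e ∈ l, (Nat.unpair e).1 = k → (Nat.unpair e).2 = f) :
    lookupPair k l = f ∨ lookupPair k l = 0 ∧ ∀ e ∈ l, (Nat.unpair e).1 ≠ k := by
  induction l with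
  | nil => exact Or.inr ⟨rfl, by simp⟩
  | cons e l ih =>
    have hcons : lookupPair k (e :: l) =
      if (Nat.unpair e).1 = k then (Nat.unpair e).2 else lookupPair k l := rfl
    rw [hcons]
    split_ifs with he
    · exact Or.inl (h e (by simp) he)
    · refine (ih fun e' he' => h e' (List.mem_cons_of_mem _ he')).imp_right fun h' => ⟨h'.1, ?_⟩
      rw [List.forall_mem_cons]
      exact ⟨he, h'.2⟩

end Lookup

namespace RootedNetwork

section Labels

variable {X β γ : Type*} (S : RootedNetwork X β γ) (big : List X)

/-- The label entry with the first child fragment of the root `r` for the color `c`. -/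
noncomputable def entry (r : X) (c : γ) : ℕ :=
  Nat.pair (Nat.pair (S.id r) (S.cid c)) (S.firstHop c r)

open Classical in
/-- The label of a vertex; the list `big` contains the roots of the deep trees. -/
noncomputable def vertexLabel (v : X) : List ℕ :=
  [S.id v, S.id (S.root v)] ++ if S.root v ∈ big then [] else
    (List.range (S.depth v)).map fun i => S.entry (S.root v) (S.color (S.edge (S.par^[i] v)))

/-- The label of a color. -/
noncomputable def colorLabel (c : γ) : List ℕ :=
  S.cid c :: big.map fun r => S.entry r c

variable {S} {big} {c : γ}

theorem iterate_par (hd : ∀ v, v = S.root v → S.depth v = 0) (v : X) (i : ℕ)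
    (hi : i ≤ S.depth v) :
    S.depth (S.par^[i] v) + i = S.depth v ∧ S.root (S.par^[i] v) = S.root v := by
  induction i with
  | zero => exact ⟨rfl, rfl⟩
  | succ i ih =>
    obtain ⟨h1, h2⟩ := ih (by omega)
    have hne : S.par^[i] v ≠ S.root (S.par^[i] v) := fun h => by
      have := hd _ h
      omega
    have h3 := S.depth_par hne
    rw [Function.iterate_succ_apply']
    exact ⟨by omega, by rw [← S.root_eq (S.link_edge hne), h2]⟩

theorem exists_iterate_par {v w : X} (h : Descends (S.up c) v w) :
    ∃ i, S.par^[i] v = w ∧ S.depth w + i = S.depth v := by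
  induction h with
  | refl => exact ⟨0, rfl, rfl⟩
  | tail _ h ih =>
    obtain ⟨i, rfl, h2⟩ := ih
    obtain ⟨h3, rfl⟩ := treeUp_eq_some.1 (up_eq_some.1 h).1
    have := S.depth_par h3
    exact ⟨i + 1, Function.iterate_succ_apply' _ _ _, by omega⟩

theorem unpair_entry (r : X) (c : γ) : Nat.unpair (S.entry r c) =
    (Nat.pair (S.id r) (S.cid c), S.firstHop c r) := Nat.unpair_pair _ _

theorem mem_drop_vertexLabel {v : X} {a : ℕ} (ha : a ∈ (S.vertexLabel big v).drop 2) :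
    ∃ i < S.depth v, a = S.entry (S.root v) (S.color (S.edge (S.par^[i] v))) := by
  rw [vertexLabel, List.drop_left' (by rfl)] at ha
  split_ifs at ha
  · simp at ha
  · obtain ⟨i, hi, rfl⟩ := List.mem_map.1 ha
    exact ⟨i, List.mem_range.1 hi, rfl⟩

/-- The parent edge of the top has color `c` and lies on the tree path from `v` to the root, all of
whose colors are listed. -/
theorem entry_mem_drop_vertexLabel {v : X} (hb : S.root v ∉ big)
    (hv : S.top c v ≠ S.root v) : S.entry (S.root v) c ∈ (S.vertexLabel big v).drop 2 := by
  rw [vertexLabel, List.drop_left' (by rfl), if_neg hb]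
  obtain ⟨i, hi, hd⟩ := exists_iterate_par (S.descends_top c v)
  have hne : S.top c v ≠ S.root (S.top c v) := by rwa [root_top]
  have := S.depth_par hne
  refine List.mem_map.2 ⟨i, List.mem_range.2 (by omega), ?_⟩
  rw [hi, (up_eq_none.1 (S.up_top c v)).resolve_left hne]

/-- The first child fragment of the root is found in the labels whenever it is needed. -/
theorem lookupPair_labels (hd : ∀ v, v = S.root v → S.depth v = 0) {s t : X}
    (hst : S.root s = S.root t) {f : ℕ}
    (hf : f = lookupPair (Nat.pair (S.id (S.root s)) (S.cid c))
      ((S.vertexLabel big s).drop 2 ++ ((S.vertexLabel big t).drop 2 ++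
        (S.colorLabel big c).drop 1))) :
    (f = S.firstHop c (S.root s) ∨ f = 0) ∧
      (S.top c s = S.root s → S.top c t = S.root s ∨ f = S.firstHop c (S.root s)) ∧
      (S.top c s ≠ S.root s → f = S.firstHop c (S.root s)) := by
  have key : ∀ v, S.root v = S.root s → ∀ a ∈ (S.vertexLabel big v).drop 2,
      (Nat.unpair a).1 = Nat.pair (S.id (S.root s)) (S.cid c) →
      (Nat.unpair a).2 = S.firstHop c (S.root s) := by
    intro v hv a ha hk
    obtain ⟨i, hi, rfl⟩ := mem_drop_vertexLabel ha
    obtain ⟨h1, h2⟩ := iterate_par hd v i hi.le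
    have hne : S.par^[i] v ≠ S.root (S.par^[i] v) := fun h => by
      have := hd _ h
      omega
    rw [unpair_entry, Nat.pair_eq_pair] at hk
    rw [unpair_entry, S.eq_of_cid_eq (S.link_edge hne) hk.2, hv]
  have hl : ∀ a ∈ (S.vertexLabel big s).drop 2 ++ ((S.vertexLabel big t).drop 2 ++
      (S.colorLabel big c).drop 1),
      (Nat.unpair a).1 = Nat.pair (S.id (S.root s)) (S.cid c) →
      (Nat.unpair a).2 = S.firstHop c (S.root s) := by
    intro a ha hk
    rw [List.mem_append, List.mem_append] at ha
    rcases ha with ha | ha | ha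
    · exact key s rfl a ha hk
    · exact key t hst.symm a ha hk
    · obtain ⟨r, -, rfl⟩ := List.mem_map.1 ha
      rw [unpair_entry, Nat.pair_eq_pair] at hk
      rw [unpair_entry, S.id_injective hk.1]
  have hspec := lookupPair_eq hl
  rw [← hf] at hspec
  have hmem : ∀ a, a = S.entry (S.root s) c →
      a ∈ (S.vertexLabel big s).drop 2 ++ ((S.vertexLabel big t).drop 2 ++
        (S.colorLabel big c).drop 1) → f = S.firstHop c (S.root s) := by
    rintro a rfl ha
    exact hspec.resolve_right fun h => h.2 _ ha (by rw [unpair_entry])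
  have hbig : S.root s ∈ big → f = S.firstHop c (S.root s) := fun hb =>
    hmem _ rfl (List.mem_append_right _ (List.mem_append_right _
      (List.mem_map.2 ⟨_, hb, rfl⟩)))
  refine ⟨hspec.imp_right And.left, fun _ => or_iff_not_imp_left.2 fun h => ?_, fun h => ?_⟩
  · by_cases hb : S.root s ∈ big
    · exact hbig hb
    · refine hmem _ rfl (List.mem_append_right _ (List.mem_append_left _ ?_))
      rw [hst] at hb h ⊢
      exact entry_mem_drop_vertexLabel hb h
  · by_cases hb : S.root s ∈ big
    · exact hbig hb
    · exact hmem _ rfl (List.mem_append_left _ (entry_mem_drop_vertexLabel hb h))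

/-! ### Sizes of tables and labels -/

variable {N M : ℕ}

theorem Bounds.childCode_minOption_le (hB : S.Bounds N M) {s : Set X}
    (hs : ∀ w ∈ s, w ≠ S.root w) : S.childCode (minOption S.id s) ≤ N + 1 := by
  rcases h : minOption S.id s with _ | w
  · exact Nat.zero_le _
  · exact hB.childCode_le (treeUp_eq_some.2 ⟨hs w (minOption_mem h), rfl⟩)

theorem Bounds.codeTriple_le (hB : S.Bounds N M) {s : Set X} (hs : ∀ w ∈ s, w ≠ S.root w) :
    ∀ a ∈ S.codeTriple s, a ≤ N + 1 := by
  simp only [codeTriple, List.mem_cons, List.not_mem_nil, or_false, forall_eq_or_imp, forall_eq]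
  refine ⟨?_, ?_, hB.childCode_minOption_le hs⟩
  · rcases minOption S.id s with _ | w
    · exact Nat.zero_le _
    · exact (hB.cid_le _).trans (Nat.le_succ _)
  · rcases minOption S.id s with _ | w
    · exact Nat.zero_le _
    · exact hB.childCode_minOption_le fun w hw => hs w hw.1

theorem Bounds.table_le (hB : S.Bounds N M) (v : X) : ∀ a ∈ S.table v, a ≤ M := by
  have h1 := hB.le
  have h2 := hB.le'
  have h3 := hB.id_le v
  have h4 := hB.cid_le (S.color (S.edge v))
  have h5 := hB.nextHop_le (c := S.color (S.edge v)) v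
  have h6 := hB.firstHop_le (c := S.color (S.edge v)) v
  have h7 := hB.exitHop_le (c := S.color (S.edge v)) v
  intro a ha
  simp only [table, List.mem_append, List.mem_cons, List.not_mem_nil, or_false] at ha
  rcases ha with ((((rfl | rfl | rfl) | ha) | ha) | (rfl | rfl | rfl))
  · omega
  · unfold upCode
    split_ifs with h
    · omega
    · have := hB.port_le (S.link_edge h)
      omega
  · omega
  · have := hB.codeTriple_le (fun w hw => (treeUp_eq_some.1 hw).1) a ha
    omega
  · have := hB.codeTriple_le (fun w hw => (treeUp_eq_some.1 hw.1.choose_spec.2).1) a ha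
    omega
  · split_ifs <;> omega
  · omega
  · omega

theorem Bounds.entry_le (hB : S.Bounds N M) (r : X) (c : γ) :
    S.entry r c + 1 ≤ ((M + 1) ^ 2 + 1) ^ 2 := by
  have h1 := hB.le
  have h2 := hB.le'
  have h3 : Nat.pair (S.id r) (S.cid c) < (M + 1) ^ 2 :=
    (Nat.pair_lt_max_add_one_sq _ _).trans_le (Nat.pow_le_pow_left (Nat.succ_le_succ
      (max_le ((hB.id_le r).trans (by omega)) ((hB.cid_le c).trans (by omega)))) 2)
  have h4 : S.firstHop c r ≤ (M + 1) ^ 2 :=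
    (hB.firstHop_le r).trans (Nat.pow_le_pow_left (by omega) 2)
  exact (Nat.pair_lt_max_add_one_sq _ _).trans_le (Nat.pow_le_pow_left (Nat.succ_le_succ
    (max_le h3.le h4)) 2)

theorem Bounds.vertexLabel_le (hB : S.Bounds N M) (v : X) :
    ∀ a ∈ S.vertexLabel big v, a + 1 ≤ ((M + 1) ^ 2 + 1) ^ 2 := by
  have h2 := hB.le'
  have hM : M + 1 ≤ ((M + 1) ^ 2 + 1) ^ 2 := by nlinarith
  intro a ha
  rw [vertexLabel, List.mem_append] at ha
  rcases ha with ha | ha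
  · simp only [List.mem_cons, List.not_mem_nil, or_false] at ha
    have h3 := hB.id_le v
    have h4 := hB.id_le (S.root v)
    rcases ha with rfl | rfl <;> omega
  · split_ifs at ha
    · simp at ha
    · obtain ⟨i, -, rfl⟩ := List.mem_map.1 ha
      exact hB.entry_le _ _

theorem Bounds.colorLabel_le (hB : S.Bounds N M) (c : γ) :
    ∀ a ∈ S.colorLabel big c, a + 1 ≤ ((M + 1) ^ 2 + 1) ^ 2 := by
  have h2 := hB.le'
  have hM : M + 1 ≤ ((M + 1) ^ 2 + 1) ^ 2 := by nlinarith
  intro a ha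
  rw [colorLabel, List.mem_cons] at ha
  rcases ha with rfl | ha
  · have h3 := hB.cid_le c
    omega
  · obtain ⟨i, -, rfl⟩ := List.mem_map.1 ha
    exact hB.entry_le _ _

theorem length_vertexLabel {b : ℕ} (hb : ∀ v, S.root v ∉ big → S.depth v ≤ b) (v : X) :
    (S.vertexLabel big v).length ≤ 2 + b := by
  rw [vertexLabel, List.length_append]
  split_ifs with h
  · simp
  · simpa using hb v h

theorem length_colorLabel (c : γ) : (S.colorLabel big c).length = big.length + 1 := by
  simp [colorLabel]

end Labels

end RootedNetwork

/-! ### The network of a colored graph -/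

section Network

variable {α β γ : Type*} {G : Graph α β}

theorem one_le_bp (hfin : V(G).Finite) {e : β} {u v : α} (h : G.IsLink e u v) (hne : u ≠ v) :
    1 ≤ bp G := by
  have : Finite V(G) := hfin
  refine le_csSup (bddAbove_hasBallPacking _) ⟨fun _ => ⟨u, h.left_mem⟩, fun _ => ?_, ?_⟩
  · refine ⟨⟨v, h.right_mem⟩, ?_⟩
    rw [Nat.cast_one, SimpleGraph.edist_eq_one_iff_adj]
    exact ⟨fun h' => hne (congrArg Subtype.val h'), h.adj⟩
  · exact fun i j hij => absurd (Subsingleton.elim i j) hij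

/-- A color is named after one end of a representative edge and the port there; division by `P + 1`
recovers both, and they determine the edge. Colors of no edge get `0`. This keeps names polynomial
in `n` for an arbitrary type of colors. -/
theorem exists_color_names (color : β → γ) {port : α → β → ℕ} {P n : ℕ}
    (hport : IsPortNumbering G port P) {id : V(G) → ℕ} (hid : Function.Injective id)
    (hn : ∀ v, id v < n) : ∃ cid : γ → ℕ, (∀ c, cid c ≤ n * (P + 1)) ∧
      ∀ e u v c, G.IsLink e u v → cid (color e) = cid c → color e = c := by
  have : ∀ c : γ, ∃ q : Option (V(G) × β), (q = none → ∀ e u v, G.IsLink e u v → color e ≠ c) ∧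
      ∀ p, q = some p → G.Inc p.2 p.1 ∧ color p.2 = c := by
    intro c
    by_cases h : ∃ e u v, G.IsLink e u v ∧ color e = c
    · obtain ⟨e, u, v, h, hc⟩ := h
      refine ⟨some (⟨u, h.left_mem⟩, e), by simp, ?_⟩
      rintro _ ⟨⟩
      exact ⟨h.inc_left, hc⟩
    · exact ⟨none, fun _ e u v h' hc => h ⟨e, u, v, h', hc⟩, by simp⟩
  choose f hf1 hf2 using this
  refine ⟨fun c => (f c).elim 0 fun p => id p.1 * (P + 1) + port p.1 p.2 + 1, fun c => ?_, ?_⟩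
  · change (f c).elim 0 _ ≤ _
    rcases h : f c with _ | p
    · exact Nat.zero_le _
    · have h1 := (hport p.1 p.1.2).2 _ (hf2 c p h).1
      have h2 := hn p.1
      change id p.1 * (P + 1) + port p.1 p.2 + 1 ≤ _
      nlinarith
  · intro e u v c h heq
    rcases h1 : f (color e) with _ | p
    · exact absurd rfl (hf1 _ h1 e u v h)
    rcases h2 : f c with _ | q
    · simp [h1, h2] at heq
    obtain ⟨hp, hp'⟩ := hf2 _ _ h1
    obtain ⟨hq, hq'⟩ := hf2 _ _ h2
    simp only [h1, h2, Option.elim, add_left_inj] at heq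
    have hpP := (hport p.1 p.1.2).2 _ hp
    have hqP := (hport q.1 q.1.2).2 _ hq
    have hdiv : ∀ a b, b ≤ P →
        (a * (P + 1) + b) / (P + 1) = a ∧ (a * (P + 1) + b) % (P + 1) = b := by
      intro a b hb
      rw [add_comm, Nat.add_mul_div_right _ _ (Nat.succ_pos P), Nat.add_mul_mod_self_right]
      exact ⟨by rw [Nat.div_eq_of_lt (by omega), zero_add], Nat.mod_eq_of_lt (by omega)⟩
    have hpd := hdiv (id p.1) _ hpP
    rw [heq] at hpd
    have hqd := hdiv (id q.1) _ hqP
    have hpq : p.1 = q.1 := hid (hpd.1.symm.trans hqd.1)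
    have hpo : port p.1 p.2 = port p.1 q.2 := by
      rw [← hpd.2, hqd.2, hpq]
    have he : p.2 = q.2 := (hport p.1 p.1.2).1 hp (hpq ▸ hq) hpo
    rw [← hp', he, hq']

/-- The network of a graph with a breadth-first spanning forest. -/
theorem exists_network [Nonempty β] (hfin : V(G).Finite) (color : β → γ) {port : α → β → ℕ}
    {P : ℕ} (hport : IsPortNumbering G port P) : ∃ S : RootedNetwork V(G) β γ,
      (∀ e u v, S.link e u v ↔ G.IsLink e u v) ∧ S.color = color ∧
      (∀ v e, S.port v e = port v e) ∧ (∀ v, S.id v < V(G).ncard) ∧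
      (∀ c, S.cid c ≤ V(G).ncard * (P + 1)) ∧
      (∀ v, G.toSimpleGraph.Reachable (S.root v) v) ∧
      (∀ u v, G.toSimpleGraph.Reachable u v → S.root u = S.root v) ∧
      ∀ v, S.depth v = G.toSimpleGraph.dist (S.root v) v := by
  classical
  have : Finite V(G) := hfin
  obtain ⟨root, par, h1, h2, -, h4⟩ :=
    exists_bfs_forest G.toSimpleGraph ∅ (fun a ha => absurd ha (Set.notMem_empty a))
  let id : V(G) → ℕ := fun v => Finite.equivFin V(G) v
  have hid : Function.Injective id :=
    Fin.val_injective.comp (Finite.equivFin V(G)).injective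
  have hn : ∀ v, id v < V(G).ncard := fun v =>
    (Finite.equivFin V(G) v).2.trans_eq (Nat.card_coe_set_eq _)
  obtain ⟨cid, hc1, hc2⟩ := exists_color_names color hport hid hn
  have hedge : ∀ v, ∃ e, v ≠ root v → G.IsLink e v (par v) := by
    intro v
    by_cases h : v = root v
    · exact ⟨Classical.arbitrary β, fun h' => absurd h h'⟩
    · obtain ⟨-, e, he⟩ := (h4 v h).1
      exact ⟨e, fun _ => he⟩
  choose edge hedge using hedge
  have hroot : ∀ {e : β} {u v : V(G)}, G.IsLink e u v → root u = root v := by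
    intro e u v h
    by_cases huv : u = v
    · rw [huv]
    · exact h2 u v (SimpleGraph.Adj.reachable ⟨huv, h.adj⟩)
  refine ⟨{ link := fun e u v => G.IsLink e u v, color := color, port := fun v e => port v e
            id := id, cid := cid, root := root, par := par, edge := edge
            depth := fun v => G.toSimpleGraph.dist (root v) v
            link_symm := fun h => h.symm
            id_injective := hid
            eq_of_cid_eq := fun h h' => hc2 _ _ _ _ h h'
            link_edge := fun h => hedge _ h
            depth_par := fun {v} h => ?_
            root_eq := hroot }, fun _ _ _ => Iff.rfl, rfl, fun _ _ => rfl, hn, hc1, h1, h2,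
          fun _ => rfl⟩
  rw [← h2 _ _ (h4 v h).1.reachable]
  exact (h4 v h).2

/-- The path to the root passes through every smaller depth. This supplies the vertex at the exact
distance that a proper ball needs. -/
theorem exists_dist_eq {S : RootedNetwork V(G) β γ}
    (hdepth : ∀ v, S.depth v = G.toSimpleGraph.dist (S.root v) v) (v : V(G)) (m : ℕ)
    (hm : m ≤ S.depth v) : ∃ u, S.root u = S.root v ∧ S.depth u = m := by
  have hd : ∀ v, v = S.root v → S.depth v = 0 := by
    intro v hv
    rw [hdepth, ← hv, SimpleGraph.dist_self]
  have h := RootedNetwork.iterate_par hd v (S.depth v - m) (by omega)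
  exact ⟨_, h.2, by omega⟩

/-- At most `bp G` trees are deeper than `bp G`. -/
theorem exists_deep_roots (hfin : V(G).Finite) {S : RootedNetwork V(G) β γ}
    (h1 : ∀ v, G.toSimpleGraph.Reachable (S.root v) v)
    (h2 : ∀ u v, G.toSimpleGraph.Reachable u v → S.root u = S.root v)
    (hdepth : ∀ v, S.depth v = G.toSimpleGraph.dist (S.root v) v) :
    ∃ big : List V(G), big.length ≤ bp G ∧ ∀ v, S.root v ∉ big → S.depth v ≤ bp G := by
  classical
  have : Finite V(G) := hfin
  let B : Set V(G) := {r | r = S.root r ∧ IsProperBall G.toSimpleGraph r (bp G + 1)}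
  have hB : B.Finite := Set.toFinite B
  refine ⟨hB.toFinset.toList, ?_, fun v hv => ?_⟩
  · rw [Finset.length_toList]
    -- Distinct roots lie in distinct components, so `bp G + 1` roots in `B` would be centres of
    -- disjoint proper balls of radius `bp G + 1`.
    by_contra! hlt
    obtain ⟨C, hC, hcard⟩ := Finset.exists_subset_card_eq (Nat.succ_le_of_lt hlt)
    let f : Fin (bp G + 1) → V(G) := fun i => (C.equivFinOfCardEq hcard).symm i
    have hf : ∀ i, f i ∈ B := fun i =>
      hB.mem_toFinset.1 (hC ((C.equivFinOfCardEq hcard).symm i).2)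
    have hpack : HasBallPacking G.toSimpleGraph (bp G + 1) := by
      refine ⟨f, fun i => (hf i).2, fun i j hij => Set.disjoint_left.2 fun u hu hu' => hij ?_⟩
      have hreach : ∀ i, u ∈ closedBall G.toSimpleGraph (f i) (bp G + 1) →
          S.root u = f i := by
        intro i hi
        have : G.toSimpleGraph.edist (f i) u ≠ ⊤ :=
          (lt_of_le_of_lt hi (ENat.natCast_lt_top _)).ne
        rw [(hf i).1]
        exact (h2 _ _ (SimpleGraph.edist_ne_top_iff_reachable.1 this)).symm
      have : f i = f j := (hreach i hu).symm.trans (hreach j hu')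
      exact (C.equivFinOfCardEq hcard).symm.injective (Subtype.ext this)
    have : bp G + 1 ≤ bp G := le_csSup (bddAbove_hasBallPacking _) hpack
    omega
  · by_contra! hlt
    refine hv (Finset.mem_toList.2 (hB.mem_toFinset.2 ⟨(h2 _ _ (h1 v)).symm, ?_⟩))
    obtain ⟨u, hu, hd⟩ := exists_dist_eq hdepth v (bp G + 1) hlt
    refine ⟨u, ?_⟩
    rw [← hu, ← (h1 u).coe_dist_eq_edist, ← hdepth, hd]

end Network

/-! ### From the network to the graph, and the final constants -/

section Main

variable {α β γ : Type*} {G : Graph α β}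

theorem delivers_of_run {S : RootedNetwork V(G) β γ}
    (hlink : ∀ e u v, S.link e u v ↔ G.IsLink e u v) {port : α → β → ℕ}
    (hport : ∀ v e, S.port v e = port v e) {table : α → List Bool}
    (htable : ∀ v : V(G), table v = encodeList (S.table v)) {c : γ} {t : V(G)} {M : ℕ} {b : ℝ}
    (hb : ∀ h, RootedNetwork.Admissible M h → ((encodeList h).length : ℝ) ≤ b) {v : V(G)}
    {h : List ℕ} (hr : S.Run c t M v h) :
    Delivers tourAlgorithm G S.color port table c b t v (encodeList h) := by
  have hfwd : ∀ (v : V(G)) h, tourAlgorithm.forward (table v) (encodeList h) =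
      (step (S.table v) h).map fun y => (y.1, encodeList y.2) := by
    intro v h
    simp only [tourAlgorithm, htable, decodeList_encodeList]
  induction hr with
  | arrive hh hs => exact .arrive (hb _ hh) (by rw [hfwd, hs]; rfl)
  | hop hh hs hl hp hc _ ih =>
    exact .hop (hb _ hh) (by rw [hfwd, hs]; rfl) ((hlink _ _ _).1 hl)
      ((hport _ _).symm.trans hp) hc ih

theorem reachable_of_connects {S : RootedNetwork V(G) β γ}
    (hlink : ∀ e u v, S.link e u v ↔ G.IsLink e u v) {c : γ} {s t : α}
    (h : Connects (deleteColor G S.color c) s t) : ∃ (hs : s ∈ V(G)) (ht : t ∈ V(G)),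
      S.root ⟨s, hs⟩ = S.root ⟨t, ht⟩ ∧
      (S.fragGraph c).Reachable (S.top c ⟨s, hs⟩) (S.top c ⟨t, ht⟩) := by
  obtain ⟨hs, h⟩ := h
  refine ⟨hs, ?_⟩
  induction h with
  | refl => exact ⟨hs, rfl, .refl _⟩
  | @tail u v _ huv ih =>
    obtain ⟨hu, hroot, hreach⟩ := ih
    obtain ⟨e, he⟩ := huv
    obtain ⟨he', hc⟩ : G.IsLink e u v ∧ e ∉ {e | S.color e = c} := by
      simpa [deleteColor] using he
    have hl := (hlink e ⟨u, hu⟩ ⟨v, he'.right_mem⟩).2 he'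
    refine ⟨he'.right_mem, hroot.trans (S.root_eq hl), hreach.trans ?_⟩
    by_cases heq : S.top c ⟨u, hu⟩ = S.top c ⟨v, he'.right_mem⟩
    · rw [heq]
    · exact SimpleGraph.Adj.reachable ⟨heq, e, _, _, hl, hc, rfl, rfl⟩

/-- A bound for the numbers in the tables, labels and headers. -/
theorem exists_bound {n k : ℕ} (hn : 2 ≤ n) : ∃ s : ℕ,
    ((((n * (n ^ k + 1) + 1) ^ 2 + 2 + 1) ^ 2 + 1) ^ 2 ≤ 2 ^ s) ∧
      ((2 * s + 1 : ℕ) : ℝ) ≤ 168 * (k + 2) * Real.log n := by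
  have hL : 1 ≤ Nat.log 2 n := Nat.log_pos one_lt_two hn
  -- With `a = n ^ (k + 2)`, the numbers are at most `a ^ 14`, and `a ≤ 2 ^ (2 * (k + 2) * Nat.log 2
  -- n)`. Raising `2 * 28` to `84` absorbs the `+ 1`, and `Nat.log 2 n ≤ 2 * Real.log n` doubles
  -- `84` to `168`.
  refine ⟨28 * (k + 2) * Nat.log 2 n, ?_, ?_⟩
  · have ha4 : 4 ≤ n ^ (k + 2) := calc
      4 = 2 ^ 2 := rfl
      _ ≤ n ^ 2 := Nat.pow_le_pow_left hn 2
      _ ≤ n ^ (k + 2) := Nat.pow_le_pow_right (by omega) (by omega)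
    have hN : n * (n ^ k + 1) ≤ n ^ (k + 2) := by
      have h1 : 1 ≤ n ^ k := Nat.one_le_pow _ _ (by omega)
      calc n * (n ^ k + 1) ≤ n * (n * n ^ k) := Nat.mul_le_mul_left _ (by nlinarith)
        _ = n ^ (k + 2) := by ring
    have hna : n ^ (k + 2) ≤ 2 ^ (2 * Nat.log 2 n * (k + 2)) := by
      rw [pow_mul]
      refine Nat.pow_le_pow_left ((Nat.lt_pow_succ_log_self one_lt_two n).le.trans ?_) _
      exact Nat.pow_le_pow_right two_pos (by omega)
    generalize n ^ (k + 2) = a at *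
    have h1 : (n * (n ^ k + 1) + 1) ^ 2 + 2 + 1 ≤ a ^ 3 := by
      have := Nat.pow_le_pow_left (Nat.succ_le_succ hN) 2
      have h2 : (a + 1) ^ 2 + 3 ≤ a ^ 3 := by
        nlinarith [Nat.mul_le_mul ha4 ha4, mul_pos (show 0 < a by omega) (show 0 < a by omega)]
      simp only [Nat.succ_eq_add_one] at this
      omega
    have h2 : ((n * (n ^ k + 1) + 1) ^ 2 + 2 + 1) ^ 2 + 1 ≤ a ^ 7 := by
      have := Nat.pow_le_pow_left h1 2
      have h3 : 1 ≤ a ^ 6 := Nat.one_le_pow _ _ (by omega)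
      have h4 : (a ^ 3) ^ 2 + 1 ≤ a ^ 7 := by
        calc (a ^ 3) ^ 2 + 1 = a ^ 6 + 1 := by ring
          _ ≤ a ^ 6 * 4 := by omega
          _ ≤ a ^ 6 * a := Nat.mul_le_mul_left _ ha4
          _ = a ^ 7 := by ring
      omega
    calc _ ≤ (a ^ 7) ^ 2 := Nat.pow_le_pow_left h2 2
      _ = a ^ 14 := by ring
      _ ≤ (2 ^ (2 * Nat.log 2 n * (k + 2))) ^ 14 := Nat.pow_le_pow_left hna 14
      _ = 2 ^ (28 * (k + 2) * Nat.log 2 n) := by rw [← pow_mul]; congr 1; ring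
  · have h1 : (Nat.log 2 n : ℝ) ≤ 2 * Real.log n := by
      have h2 := Real.natLog_le_logb n 2
      have h3 := Real.log_two_gt_d9
      have h4 : 0 ≤ Real.log n := Real.log_natCast_nonneg n
      rw [Real.logb, Nat.cast_ofNat, le_div_iff₀ (by linarith)] at h2
      have h5 : (0 : ℝ) ≤ Nat.log 2 n := Nat.cast_nonneg _
      nlinarith
    have h6 : 2 * (28 * (k + 2) * Nat.log 2 n) + 1 ≤ 84 * (k + 2) * Nat.log 2 n := by
      have : 1 ≤ (k + 2) * Nat.log 2 n := Nat.mul_pos (by omega) hL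
      nlinarith
    calc ((2 * (28 * (k + 2) * Nat.log 2 n) + 1 : ℕ) : ℝ)
        ≤ ((84 * (k + 2) * Nat.log 2 n : ℕ) : ℝ) := Nat.cast_le.2 h6
      _ = 84 * (k + 2) * (Nat.log 2 n : ℝ) := by push_cast; ring
      _ ≤ 84 * (k + 2) * (2 * Real.log n) := by gcongr
      _ = 168 * (k + 2) * Real.log n := by ring

theorem length_encodeList_le {l : List ℕ} {s m : ℕ} {L : ℝ} (hl : ∀ a ∈ l, a + 1 ≤ 2 ^ s)
    (hs : ((2 * s + 1 : ℕ) : ℝ) ≤ L) (hm : l.length ≤ m) :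
    ((encodeList l).length : ℝ) ≤ m * L :=
  calc ((encodeList l).length : ℝ) ≤ ((l.length * (2 * s + 1) : ℕ) : ℝ) :=
        Nat.cast_le.2 (length_encodeList l s fun a ha => hl a ha)
    _ = l.length * ((2 * s + 1 : ℕ) : ℝ) := Nat.cast_mul _ _
    _ ≤ m * L := by gcongr

theorem forward_nil : tourAlgorithm.forward [] [] = none := rfl

/-- Without edges between distinct vertices, empty tables and labels suffice. -/
theorem delivers_of_forall_eq (h : ∀ e u v, G.IsLink e u v → u = v) {color : β → γ}
    {port : α → β → ℕ} {c : γ} {s t : α} (hst : Connects (deleteColor G color c) s t) {b : ℝ}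
    (hb : 0 ≤ b) :
    Delivers tourAlgorithm G color port (fun _ => []) c b t s (tourAlgorithm.start [] [] []) := by
  obtain ⟨-, hst⟩ := hst
  obtain rfl : s = t := by
    induction hst with
    | refl => rfl
    | tail _ huv ih =>
      obtain ⟨e, he⟩ := huv
      have he' : G.IsLink e _ _ := Graph.IsLink.mono Graph.deleteEdges_le he
      exact ih.trans (h _ _ _ he')
  exact .arrive (by simpa [tourAlgorithm] using hb) forward_nil

end Main

end ColorRouting

theorem theoremB1 :
    ∃ alg : ColorRouting.RoutingAlgorithm, ∀ k : ℕ, ∃ K : ℝ,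
      ∀ (α β γ : Type*) (G : Graph α β) (color : β → γ) (port : α → β → ℕ),
        V(G).Finite →
        ColorRouting.IsPortNumbering G port (V(G).ncard ^ k) →
        ∃ (table : α → List Bool) (vertexLabel : α → List Bool) (colorLabel : γ → List Bool),
          (∀ v ∈ V(G), ((table v).length : ℝ) ≤
            K * (ColorRouting.bp G * Real.log V(G).ncard)) ∧
          (∀ v ∈ V(G), ((vertexLabel v).length : ℝ) ≤
            K * (ColorRouting.bp G * Real.log V(G).ncard)) ∧
          (∀ c : γ, ((colorLabel c).length : ℝ) ≤
            K * (ColorRouting.bp G * Real.log V(G).ncard)) ∧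
          ∀ (c : γ) (s t : α),
            ColorRouting.Connects (ColorRouting.deleteColor G color c) s t →
            ColorRouting.Delivers alg G color port table c (K * Real.log V(G).ncard) t s
              (alg.start (vertexLabel s) (vertexLabel t) (colorLabel c)) := by
  open ColorRouting in
  classical
  -- A table has twelve numbers, a header six, and a label at most `2 + bp G`, which is at most `12
  -- * bp G` once `1 ≤ bp G`.
  refine ⟨tourAlgorithm, fun k => ⟨12 * (168 * (k + 2)), ?_⟩⟩
  intro α β γ G color port hfin hport
  have hlog : 0 ≤ Real.log V(G).ncard := Real.log_natCast_nonneg _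
  -- Without edges between distinct vertices `bp G = 0`, so tables and labels must be empty;
  -- otherwise `1 ≤ bp G` absorbs the constant terms.
  by_cases hne : ∀ e u v, G.IsLink e u v → u = v
  · refine ⟨fun _ => [], fun _ => [], fun _ => [], ?_, ?_, ?_, fun c s t hst =>
      delivers_of_forall_eq hne hst (by positivity)⟩ <;>
    · intros
      rw [List.length_nil, Nat.cast_zero]
      positivity
  push Not at hne
  obtain ⟨e, u, v, he, huv⟩ := hne
  have hbp : 1 ≤ bp G := one_le_bp hfin he huv
  have hn : 2 ≤ V(G).ncard :=
    (Set.one_lt_ncard_iff hfin).2 ⟨u, v, he.left_mem, he.right_mem, huv⟩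
  have : Nonempty β := ⟨e⟩
  have : Finite V(G) := hfin
  obtain ⟨S, hlink, rfl, hp, hid, hcid, h1, h2, hdepth⟩ := exists_network hfin color hport
  obtain ⟨big, hbig, hsmall⟩ := exists_deep_roots hfin h1 h2 hdepth
  obtain ⟨σ, hσ, hσ'⟩ := exists_bound (k := k) hn
  obtain ⟨N, hN⟩ : ∃ N, N = V(G).ncard * (V(G).ncard ^ k + 1) := ⟨_, rfl⟩
  obtain ⟨M, hM⟩ : ∃ M, M = (N + 1) ^ 2 + 2 := ⟨_, rfl⟩
  rw [← hN, ← hM] at hσ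
  have hB : S.Bounds N M := by
    refine ⟨fun v => ?_, fun c => (hcid c).trans_eq hN.symm, fun {e u v} h => ?_, hM.ge⟩
    · have := hid v
      rw [hN]
      nlinarith [Nat.zero_le (V(G).ncard ^ k)]
    · have := (hport u u.2).2 e ((hlink e u v).1 h).inc_left
      rw [hp, hN]
      nlinarith [Nat.zero_le (V(G).ncard ^ k)]
  have hMσ : M + 1 ≤ 2 ^ σ := le_trans (by nlinarith) hσ
  have hscale : ∀ {l : List ℕ} {m : ℕ}, (∀ a ∈ l, a + 1 ≤ 2 ^ σ) → l.length ≤ m →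
      m ≤ 12 * bp G → ((encodeList l).length : ℝ) ≤
        12 * (168 * (k + 2)) * (bp G * Real.log V(G).ncard) := by
    intro l m hl hm hm'
    calc ((encodeList l).length : ℝ)
        ≤ ((12 * bp G : ℕ) : ℝ) * (168 * (k + 2) * Real.log V(G).ncard) :=
          length_encodeList_le hl hσ' (hm.trans hm')
      _ = _ := by push_cast; ring
  refine ⟨fun v => if h : v ∈ V(G) then encodeList (S.table ⟨v, h⟩) else [],
    fun v => if h : v ∈ V(G) then encodeList (S.vertexLabel big ⟨v, h⟩) else [],
    fun c => encodeList (S.colorLabel big c), fun v hv => ?_, fun v hv => ?_, fun c => ?_,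
    fun c s t hst => ?_⟩
  · simp only [dif_pos hv]
    exact hscale (m := 12) (fun a ha => (Nat.succ_le_succ (hB.table_le _ a ha)).trans hMσ)
      le_rfl (by omega)
  · simp only [dif_pos hv]
    exact hscale (fun a ha => (hB.vertexLabel_le _ a ha).trans hσ)
      (RootedNetwork.length_vertexLabel hsmall _) (by omega)
  · exact hscale (fun a ha => (hB.colorLabel_le _ a ha).trans hσ)
      (RootedNetwork.length_colorLabel c).le (by omega)
  · obtain ⟨hs, ht, hroot, hreach⟩ := reachable_of_connects hlink hst
    have hd : ∀ v, v = S.root v → S.depth v = 0 := by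
      intro v hv
      rw [hdepth, ← hv, SimpleGraph.dist_self]
    obtain ⟨hf, hF, hF'⟩ := RootedNetwork.lookupPair_labels (big := big) hd hroot (c := c) rfl
    have hfM := hB.firstHop_le (c := c) (S.root ⟨s, hs⟩)
    have hrun := RootedNetwork.run_of_reachable hB
      (by rcases hf with hf | hf <;> rw [hf] <;> omega) hreach hF hF'
    have hstart : tourAlgorithm.start (encodeList (S.vertexLabel big ⟨s, hs⟩))
        (encodeList (S.vertexLabel big ⟨t, ht⟩)) (encodeList (S.colorLabel big c)) =
        encodeList (initialHeader (S.vertexLabel big ⟨s, hs⟩) (S.vertexLabel big ⟨t, ht⟩)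
          (S.colorLabel big c)) := by
      have hnil : encodeList (S.vertexLabel big ⟨s, hs⟩) ≠ [] :=
        encodeList_ne_nil (by simp [RootedNetwork.vertexLabel])
      simp only [tourAlgorithm, if_neg hnil, decodeList_encodeList]
    simp only [dif_pos hs, dif_pos ht, hstart]
    refine delivers_of_run hlink hp (fun v => dif_pos v.2) (fun h hh => ?_) hrun
    calc ((encodeList h).length : ℝ)
        ≤ ((12 : ℕ) : ℝ) * (168 * (k + 2) * Real.log V(G).ncard) :=
          length_encodeList_le (fun a ha => (Nat.succ_le_succ (hh.2 a ha)).trans hMσ) hσ'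
            (hh.1.trans_le (by norm_num))
      _ = _ := by push_cast; ring
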